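/- Let $E_0$ be a totally real number field or $\mathbb{R}$, let $E$ be an imaginary quadratic extension of $E_0$, with nontrivial automorphism $\alpha\mapsto\bar\alpha$ over $E_0$, and let $n=2m$ be even. Let $W$ be an $E$-vector space of dimension $2n$ with an $E$-bilinear form $b$ and a nondegenerate $(E,E_0)$-Hermitian form $\psi$ which are compatible. That is, there is a good basis of $W$: an $E$-basis $e_1,\dots,e_{2n}$, elements $a_1,\dots,a_{2n}\in E_0$ and an element $\lambda\in E_0$ such that $b(z,w)=\sum_{i=1}^n(z_iw_{n+i}+z_{n+i}w_i)$, $\psi(z,w)=\sum_{i=1}^{2n}a_iz_i\bar w_i$, and $a_ia_{n+i}=\lambda$ for $1\le i\le n$. Fix such a basis, let $W_1$ be the span of $e_1,\dots,e_n$ (a good isotropic subspace), and put $D=\det(\psi|W_1)=a_1\cdots a_n$. Let $C$ be the Clifford algebra of $W$ with relations $vw+wv=b(v,w)$. It acts on $\bigwedge^\bullet W_1$: for $i\le n$, $e_i$ acts by exterior multiplication and $e_{n+i}$ by interior product with the functional $b(e_{n+i},\cdot)$. The half spin spaces, which are modules over the even Clifford algebra, are $S^+=\bigwedge^{\mathrm{even}}W_1$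 and $S^-=\bigwedge^{\mathrm{odd}}W_1$ (exterior algebra over $E$), and $\operatorname{Res}S^\pm$ denotes $S^\pm$ considered as an $E_0$-vector space. Let $G_1$ be the neutral component of the preimage in $\operatorname{Res}_{E/E_0}\mathrm{Spin}(W,b)$ of the group of $E$-linear automorphisms of $W$ preserving $b$ and $\psi$; it is an algebraic group over $E_0$ acting on $\operatorname{Res}S^\pm$. Let $\star\colon\bigwedge^kW_1\to\bigwedge^{n-k}W_1$ be the conjugate-linear Hodge operator defined by $u\wedge\star v=\psi(u,v)\,e_1\wedge\cdots\wedge e_n$, where $\psi(u_1\wedge\cdots\wedge u_k,v_1\wedge\cdots\wedge v_k)=\det(\psi(u_i,v_j))$. Then: (i) There is a conjugate-linear operator $L_+$ on $\operatorname{Res}S^+$, commuting with the action of $G_1$, such that $L_+^2=(-1)^mD\operatorname{Id}$ if $m$ is even and $L_+^2=(-1)^mD\lambda\operatorname{Id}$ if $m$ is odd. (ii) There is a conjugate-linear operator $L_-$ on $\operatorname{Res}S^-$, commuting with the action of $G_1$, such that $L_-^2=(-1)^mD\lambda\operatorname{Id}$ if $m$ is even and $L_-^2=(-1)^mD\operatorname{Id}$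 if $m$ is odd. Moreover $L_\pm$ can be chosen so that on $\bigwedge^kW_1$ they equal $(-1)^d\lambda^{-d}\star$, where $d=\lfloor (k-m)/2\rfloor$. -/

import Mathlib

open scoped TensorProduct

noncomputable section

namespace HalfSpin

section ZariskiTopology

/-- The Zariski topology on a vector space `V` over a field `K`: the topology whose basic open sets
are the non-vanishing loci of the polynomial functions on `V` (a polynomial function is a
polynomial in linear functionals on `V`). -/
abbrev zariskiTopology (K V : Type*) [Field K] [AddCommGroup V] [Module K V] : TopologicalSpace V :=
  TopologicalSpace.generateFrom
    {U | ∃ p : MvPolynomial (Module.Dual K V) K,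
      U = {v : V | MvPolynomial.eval (fun f : Module.Dual K V => f v) p ≠ 0}}

end ZariskiTopology

section Fields

/-- The ground field is a totally real number field or (isomorphic to) the field `ℝ`. -/
def IsBaseField (E₀ : Type*) [Field E₀] : Prop :=
  (NumberField E₀ ∧ NumberField.IsTotallyReal E₀) ∨ Nonempty (E₀ ≃+* ℝ)

/-- `E` is an imaginary quadratic extension of `E₀`: it has degree two and no real embedding. -/
def IsImaginaryQuadratic (E₀ E : Type*) [Field E₀] [Field E] [Algebra E₀ E] : Prop :=
  Module.finrank E₀ E = 2 ∧ IsEmpty (E →+* ℝ)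

end Fields

section Forms

variable {E₀ E W : Type*} [Field E₀] [Field E] [Algebra E₀ E]
  [AddCommGroup W] [Module E W] [Module E₀ W] [IsScalarTower E₀ E W] {n : ℕ}

/-- A nondegenerate `(E, E₀)`-Hermitian form `ψ(z, w)` on `W`, linear in `z` and conjugate linear
in `w` (a consequence of `smul_left` and `conj_symm`); `σ` is the conjugation of `E` over `E₀`. -/
structure IsHermitianForm (σ : E ≃ₐ[E₀] E) (ψ : W →ₗ[E₀] W →ₗ[E₀] E) : Prop where
  smul_left : ∀ (c : E) (z w : W), ψ (c • z) w = c * ψ z w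
  conj_symm : ∀ z w : W, σ (ψ z w) = ψ w z
  nondegenerate : ∀ z : W, (∀ w : W, ψ z w = 0) → z = 0

/-- In the basis `e` (the vectors `e (inl i)` are `e_1, …, e_n`, the vectors `e (inr i)` are
`e_{n+1}, …, e_{2n}`) the bilinear form `b` is `b(z,w) = ∑ (z_i w_{n+i} + z_{n+i} w_i)`. -/
structure IsHyperbolicBasis (b : LinearMap.BilinForm E W)
    (e : Module.Basis (Fin n ⊕ Fin n) E W) : Prop where
  inl_inl : ∀ i j, b (e (Sum.inl i)) (e (Sum.inl j)) = 0
  inr_inr : ∀ i j, b (e (Sum.inr i)) (e (Sum.inr j)) = 0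
  inl_inr : ∀ i j, b (e (Sum.inl i)) (e (Sum.inr j)) = if i = j then 1 else 0
  inr_inl : ∀ i j, b (e (Sum.inr i)) (e (Sum.inl j)) = if i = j then 1 else 0

/-- `e` is a good basis for the pair `b`, `ψ`, with coefficients `a` and `lam`: `b` has the standard
hyperbolic form in `e`, `ψ(z,w) = ∑ a_r z_r σ(w_r)`, and `a_i a_{n+i} = lam` for all `i ≤ n`.
The existence of such a basis is the compatibility of `b` and `ψ`. -/
structure IsGoodBasis (b : LinearMap.BilinForm E W) (ψ : W →ₗ[E₀] W →ₗ[E₀] E)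
    (e : Module.Basis (Fin n ⊕ Fin n) E W) (a : Fin n ⊕ Fin n → E₀) (lam : E₀) : Prop where
  hyperbolic : IsHyperbolicBasis b e
  diagonal : ∀ r s, ψ (e r) (e s) = if r = s then algebraMap E₀ E (a r) else 0
  mul_eq : ∀ i, a (Sum.inl i) * a (Sum.inr i) = lam

/-- The discriminant `D = a_1 ⋯ a_n` of the restriction of `ψ` to `W₁ = span(e_1, …, e_n)`. -/
def discr (a : Fin n ⊕ Fin n → E₀) : E₀ := ∏ i : Fin n, a (Sum.inl i)

/-- The quadratic form `w ↦ b(w,w)/2`. In its Clifford algebra `v w + w v = b(v,w)` for a symmetric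
form `b`; in a hyperbolic basis, `e_i e_{n+i} + e_{n+i} e_i = 1`. -/
def quad (b : LinearMap.BilinForm E W) : QuadraticForm E W :=
  (2⁻¹ : E) • LinearMap.BilinMap.toQuadraticMap b

/-- The isotropic subspace `W₁ = span(e_1, …, e_n)`. -/
def W₁ (e : Module.Basis (Fin n ⊕ Fin n) E W) : Submodule E W :=
  Submodule.span E (Set.range fun i : Fin n => e (Sum.inl i))

/-- The vectors `e_1, …, e_n` as elements of `W₁`. -/
def e₁ (e : Module.Basis (Fin n ⊕ Fin n) E W) (i : Fin n) : W₁ e :=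
  ⟨e (Sum.inl i), Submodule.subset_span ⟨i, rfl⟩⟩

/-- The projection `W = W₁ ⊕ W₂ → W₁`, with `W₂ = span(e_{n+1}, …, e_{2n})`. -/
def proj₁ (e : Module.Basis (Fin n ⊕ Fin n) E W) : W →ₗ[E] W₁ e :=
  e.constr E (Sum.elim (e₁ e) fun _ => 0)

end Forms

section SpinRepresentation

variable {E W : Type*} [Field E] [AddCommGroup W] [Module E W] {n : ℕ}
  {b : LinearMap.BilinForm E W} {e : Module.Basis (Fin n ⊕ Fin n) E W}

/-- The operator on `⋀ W₁` attached to `w ∈ W`: exterior multiplication by the `W₁`-component of `w`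
plus interior product with the functional `b(w, ·)` on `W₁` (which only depends on the
`W₂`-component of `w`). Thus `e_i` acts as `ℓ(e_i)` and `e_{n+i}` acts as `ι(e_{n+i})`. -/
def vectorAction (b : LinearMap.BilinForm E W) (e : Module.Basis (Fin n ⊕ Fin n) E W) :
    W →ₗ[E] Module.End E (ExteriorAlgebra E (W₁ e)) :=
  LinearMap.mul E (ExteriorAlgebra E (W₁ e)) ∘ₗ ExteriorAlgebra.ι E ∘ₗ proj₁ e +
    CliffordAlgebra.contractLeft ∘ₗ LinearMap.compl₂ b (W₁ e).subtype

theorem vectorAction_apply (w : W) (x : ExteriorAlgebra E (W₁ e)) :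
    vectorAction b e w x = ExteriorAlgebra.ι E (proj₁ e w) * x +
      CliffordAlgebra.contractLeft (LinearMap.compl₂ b (W₁ e).subtype w) x := rfl

theorem proj₁_inl (i : Fin n) : ((proj₁ e (e (Sum.inl i)) : W₁ e) : W) = e (Sum.inl i) := by
  simp [proj₁, e₁]

theorem proj₁_inr (i : Fin n) : ((proj₁ e (e (Sum.inr i)) : W₁ e) : W) = 0 := by
  simp [proj₁]

theorem form_proj₁ (hb : IsHyperbolicBasis b e) (z w : W) :
    b z (proj₁ e w) + b (proj₁ e z) w = b z w := by
  have h : LinearMap.compl₂ b ((W₁ e).subtype ∘ₗ proj₁ e) +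
      LinearMap.comp b ((W₁ e).subtype ∘ₗ proj₁ e) = b := by
    refine e.ext fun r => e.ext fun s => ?_
    rcases r with i | i <;> rcases s with j | j <;>
      simp [proj₁_inl, proj₁_inr, hb.inl_inl, hb.inl_inr, hb.inr_inl, hb.inr_inr]
  exact congrArg (fun f : LinearMap.BilinForm E W => f z w) h

theorem form_symm (hb : IsHyperbolicBasis b e) (z w : W) : b z w = b w z := by
  have h : b = b.flip := by
    refine e.ext fun r => e.ext fun s => ?_
    rcases r with i | i <;> rcases s with j | j <;>
      simp [hb.inl_inl, hb.inl_inr, hb.inr_inl, hb.inr_inr, eq_comm]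
  exact congrArg (fun f : LinearMap.BilinForm E W => f z w) h

theorem vectorAction_mul_self [CharZero E] (hb : IsHyperbolicBasis b e) (w : W) :
    vectorAction b e w * vectorAction b e w =
      algebraMap E (Module.End E (ExteriorAlgebra E (W₁ e))) (quad b w) := by
  have h : b w (proj₁ e w) = 2⁻¹ * b w w := by
    have h1 := form_proj₁ hb w w
    rw [form_symm hb (proj₁ e w) w] at h1
    rw [← h1]
    ring
  refine LinearMap.ext fun x => ?_
  have h0 : ExteriorAlgebra.ι E (proj₁ e w) * (ExteriorAlgebra.ι E (proj₁ e w) * x) = 0 := by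
    rw [← mul_assoc, ExteriorAlgebra.ι_sq_zero, zero_mul]
  have h3 := CliffordAlgebra.contractLeft_ι_mul (Q := (0 : QuadraticForm E (W₁ e)))
    (d := LinearMap.compl₂ b (W₁ e).subtype w) (proj₁ e w) x
  change CliffordAlgebra.contractLeft _ (ExteriorAlgebra.ι E (proj₁ e w) * x) =
    _ - ExteriorAlgebra.ι E (proj₁ e w) * _ at h3
  rw [Module.End.mul_apply, vectorAction_apply w x, vectorAction_apply, mul_add, map_add, h0,
    CliffordAlgebra.contractLeft_contractLeft, h3, Module.algebraMap_end_apply]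
  simp [quad, h]

/-- The spin representation of the Clifford algebra on `⋀ W₁`. -/
def spinAction [CharZero E] (hb : IsHyperbolicBasis b e) :
    CliffordAlgebra (quad b) →ₐ[E] Module.End E (ExteriorAlgebra E (W₁ e)) :=
  CliffordAlgebra.lift (quad b) ⟨vectorAction b e, vectorAction_mul_self hb⟩

/-- The half spin spaces: `S e 0` is `S⁺ = ⋀^even W₁` and `S e 1` is `S⁻ = ⋀^odd W₁`. -/
def S (e : Module.Basis (Fin n ⊕ Fin n) E W) (ε : ZMod 2) :
    Submodule E (ExteriorAlgebra E (W₁ e)) :=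
  ⨆ k : {k : ℕ // (k : ZMod 2) = ε}, ⋀[E]^k.1 (W₁ e)

theorem S_eq (ε : ZMod 2) :
    S e ε = CliffordAlgebra.evenOdd (0 : QuadraticForm E (W₁ e)) ε := rfl

theorem contractLeft_mem (d : Module.Dual E (W₁ e)) (ε : ZMod 2) (x : ExteriorAlgebra E (W₁ e))
    (hx : x ∈ S e ε) : CliffordAlgebra.contractLeft d x ∈ S e (ε + 1) := by
  have key : ∀ k : ℕ, ∀ y ∈ ⋀[E]^k (W₁ e),
      CliffordAlgebra.contractLeft d y ∈ S e ((k : ZMod 2) + 1) := by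
    intro k
    induction k with
    | zero =>
      intro y hy
      obtain ⟨r, rfl⟩ := Submodule.mem_one.mp (by simpa using hy)
      have : CliffordAlgebra.contractLeft d
        (algebraMap E (CliffordAlgebra (0 : QuadraticForm E (W₁ e))) r) = 0 :=
        CliffordAlgebra.contractLeft_algebraMap _ d r
      exact this ▸ Submodule.zero_mem _
    | succ k ih =>
      intro y hy
      replace hy : y ∈ LinearMap.range (ExteriorAlgebra.ι E (M := W₁ e)) * ⋀[E]^k (W₁ e) := by
        rw [← pow_succ']
        exact hy
      refine Submodule.mul_induction_on hy ?_ ?_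
      · rintro _ ⟨v, rfl⟩ z hz
        have h3 := CliffordAlgebra.contractLeft_ι_mul (Q := (0 : QuadraticForm E (W₁ e)))
          (d := d) v z
        have hk : ((k + 1 : ℕ) : ZMod 2) + 1 = k := by
          push_cast
          rw [add_assoc, show (1 : ZMod 2) + 1 = 0 by decide, add_zero]
        refine Set.mem_of_eq_of_mem h3 ?_
        rw [hk]
        refine Submodule.sub_mem _ (Submodule.smul_mem _ _ ?_) ?_
        · exact Submodule.mem_iSup_of_mem (p := fun k' : {k' : ℕ // (k' : ZMod 2) = k} =>
            ⋀[E]^k'.1 (W₁ e)) ⟨k, rfl⟩ hz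
        · have h4 := CliffordAlgebra.evenOdd_mul_le (0 : QuadraticForm E (W₁ e)) 1 (k + 1)
            (Submodule.mul_mem_mul (CliffordAlgebra.ι_mem_evenOdd_one _ v) (ih z hz))
          have h5 : (1 : ZMod 2) + (k + 1) = k := by
            rw [add_comm, add_assoc, show (1 : ZMod 2) + 1 = 0 by decide, add_zero]
          rw [h5] at h4
          exact h4
      · intro y z hy hz
        rw [map_add]
        exact Submodule.add_mem _ hy hz
  refine Submodule.iSup_induction _
    (motive := fun x => CliffordAlgebra.contractLeft d x ∈ S e (ε + 1)) hx ?_ ?_ ?_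
  · rintro ⟨k, rfl⟩ y hy
    exact key k y hy
  · rw [map_zero]
    exact Submodule.zero_mem _
  · intro y z hy hz
    rw [map_add]
    exact Submodule.add_mem _ hy hz

theorem vectorAction_mem (w : W) (ε : ZMod 2) (x : ExteriorAlgebra E (W₁ e)) (hx : x ∈ S e ε) :
    vectorAction b e w x ∈ S e (ε + 1) := by
  rw [vectorAction_apply]
  refine Submodule.add_mem _ ?_ (contractLeft_mem _ _ _ hx)
  have h4 := CliffordAlgebra.evenOdd_mul_le (0 : QuadraticForm E (W₁ e)) 1 ε
    (Submodule.mul_mem_mul (CliffordAlgebra.ι_mem_evenOdd_one _ (proj₁ e w)) hx)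
  rw [add_comm] at h4
  exact h4

theorem spinAction_mem [CharZero E] (hb : IsHyperbolicBasis b e) (ε : ZMod 2)
    (g : CliffordAlgebra (quad b)) (hg : g ∈ CliffordAlgebra.evenOdd (quad b) 0)
    (x : ExteriorAlgebra E (W₁ e)) (hx : x ∈ S e ε) : spinAction hb g x ∈ S e ε := by
  induction g, hg using CliffordAlgebra.even_induction with
  | algebraMap r =>
    rw [AlgHom.commutes, Module.algebraMap_end_apply]
    exact Submodule.smul_mem _ _ hx
  | add g h _ _ ihg ihh =>
    rw [map_add]
    exact Submodule.add_mem _ ihg ihh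
  | ι_mul_ι_mul v w g _ ih =>
    have h := vectorAction_mem (b := b) v _ _ (vectorAction_mem (b := b) w _ _ ih)
    rw [add_assoc, show (1 : ZMod 2) + 1 = 0 by decide, add_zero] at h
    simpa [spinAction] using h

/-- The half spin representations of the even Clifford algebra on `S⁺` and `S⁻`. -/
def halfSpin [CharZero E] (hb : IsHyperbolicBasis b e) (ε : ZMod 2) :
    CliffordAlgebra.even (quad b) →ₗ[E] Module.End E (S e ε) where
  toFun g := (spinAction hb g.1).restrict fun x hx => spinAction_mem hb ε g.1 g.2 x hx
  map_add' g h := by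
    ext x
    simp
  map_smul' c g := by
    ext x
    simp

end SpinRepresentation

section Group

variable {E₀ E W : Type*} [Field E₀] [Field E] [Algebra E₀ E]
  [AddCommGroup W] [Module E W] [Module E₀ W] [IsScalarTower E₀ E W] {n : ℕ}

/-- The inclusion `C^even ⊗ K → C ⊗ K`, for a field extension `K` of `E₀`. -/
def evenIncl (K : Type*) [Field K] [Algebra E₀ K] (b : LinearMap.BilinForm E W) :
    K ⊗[E₀] CliffordAlgebra.even (quad b) →ₐ[K] K ⊗[E₀] CliffordAlgebra (quad b) :=
  Algebra.TensorProduct.map (AlgHom.id K K) ((CliffordAlgebra.even (quad b)).val.restrictScalars E₀)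

/-- The inclusion `W ⊗ K → C ⊗ K`. -/
def vecIncl (K : Type*) [Field K] [Algebra E₀ K] (b : LinearMap.BilinForm E W) :
    K ⊗[E₀] W →ₗ[K] K ⊗[E₀] CliffordAlgebra (quad b) :=
  ((CliffordAlgebra.ι (quad b)).restrictScalars E₀).baseChange K

/-- The main anti-involution `v_1 ⋯ v_r ↦ v_r ⋯ v_1`, extended to `C ⊗ K`. -/
def reverseK (K : Type*) [Field K] [Algebra E₀ K] (b : LinearMap.BilinForm E W) :
    K ⊗[E₀] CliffordAlgebra (quad b) →ₗ[K] K ⊗[E₀] CliffordAlgebra (quad b) :=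
  ((CliffordAlgebra.reverse (Q := quad b)).restrictScalars E₀).baseChange K

/-- The `K`-points of the preimage in `Res_{E/E₀} Spin(W,b)` of the group of automorphisms of `W`
which preserve `b` and `ψ`. The `K`-points of `Res_{E/E₀} Spin(W,b)` are the `g ∈ C^even ⊗ K` with
`g g^* = 1` and `g (W ⊗ K) g^* ⊆ W ⊗ K`; such a `g` lies over the automorphism
`ρ : w ↦ g w g^*` of `W ⊗ K` (which preserves `b`), and `ρ` has to preserve `ψ`. -/
def spinPreimage (K : Type*) [Field K] [Algebra E₀ K] (b : LinearMap.BilinForm E W)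
    (ψ : W →ₗ[E₀] W →ₗ[E₀] E) : Set (K ⊗[E₀] CliffordAlgebra.even (quad b)) :=
  {g | evenIncl K b g * reverseK K b (evenIncl K b g) = 1 ∧
    ∃ ρ : K ⊗[E₀] W →ₗ[K] K ⊗[E₀] W,
      (∀ w, evenIncl K b g * vecIncl K b w * reverseK K b (evenIncl K b g) = vecIncl K b (ρ w)) ∧
      ∀ z w, LinearMap.BilinMap.baseChange K ψ (ρ z) (ρ w) = LinearMap.BilinMap.baseChange K ψ z w}

/-- The algebraic group `G₁` over `E₀`, given by its points over the algebraic closure of `E₀`: the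
neutral component (the connected component of `1` in the Zariski topology) of the preimage in
`Res_{E/E₀} Spin(W,b)` of the group of automorphisms preserving `b` and `ψ`. -/
def G₁ (b : LinearMap.BilinForm E W) (ψ : W →ₗ[E₀] W →ₗ[E₀] E) :
    Set (AlgebraicClosure E₀ ⊗[E₀] CliffordAlgebra.even (quad b)) :=
  @connectedComponentIn _
    (zariskiTopology (AlgebraicClosure E₀)
      (AlgebraicClosure E₀ ⊗[E₀] CliffordAlgebra.even (quad b)))
    (spinPreimage (AlgebraicClosure E₀) b ψ) 1

/-- The group `G₁(E₀)` of rational points of `G₁`. -/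
def G₁Rational (b : LinearMap.BilinForm E W) (ψ : W →ₗ[E₀] W →ₗ[E₀] E) :
    Set (CliffordAlgebra.even (quad b)) :=
  {g | (1 : AlgebraicClosure E₀) ⊗ₜ[E₀] g ∈ G₁ b ψ}

variable [CharZero E] {b : LinearMap.BilinForm E W} {e : Module.Basis (Fin n ⊕ Fin n) E W}

/-- The action of `C^even` on `Res_{E/E₀} S^±` by `E₀`-linear maps. -/
def resAction (hb : IsHyperbolicBasis b e) (ε : ZMod 2) :
    CliffordAlgebra.even (quad b) →ₗ[E₀] Module.End E₀ (S e ε) where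
  toFun g := (halfSpin hb ε g).restrictScalars E₀
  map_add' g h := by
    ext x
    simp
  map_smul' c g := by
    refine LinearMap.ext fun x => ?_
    have h : c • g = algebraMap E₀ E c • g := (algebraMap_smul E c g).symm
    rw [h, map_smul]
    exact algebraMap_smul E c (halfSpin hb ε g x)

/-- The action of `C^even ⊗ K` on `(Res_{E/E₀} S^±) ⊗ K`. -/
def actionK (K : Type*) [Field K] [Algebra E₀ K] (hb : IsHyperbolicBasis b e) (ε : ZMod 2) :
    K ⊗[E₀] CliffordAlgebra.even (quad b) →ₗ[K] Module.End K (K ⊗[E₀] S e ε) :=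
  LinearMap.liftBaseChange K
    (LinearMap.baseChangeHom E₀ K (S e ε) (S e ε) ∘ₗ resAction hb ε)

/-- `L` is an endomorphism of the representation `Res_{E/E₀} S^±` of the algebraic group `G₁`: it
commutes with all points of `G₁` over the algebraic closure, and with all rational points. -/
def IsEquivariant (hb : IsHyperbolicBasis b e) (ψ : W →ₗ[E₀] W →ₗ[E₀] E) (ε : ZMod 2)
    (L : Module.End E₀ (S e ε)) : Prop :=
  (∀ g ∈ G₁ b ψ, ∀ x : AlgebraicClosure E₀ ⊗[E₀] S e ε,
    L.baseChange (AlgebraicClosure E₀) (actionK (AlgebraicClosure E₀) hb ε g x) =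
      actionK (AlgebraicClosure E₀) hb ε g (L.baseChange (AlgebraicClosure E₀) x)) ∧
  ∀ g ∈ G₁Rational b ψ, ∀ x : S e ε, L (halfSpin hb ε g x) = halfSpin hb ε g (L x)

end Group

section Operators

variable {E₀ E W : Type*} [Field E₀] [Field E] [Algebra E₀ E]
  [AddCommGroup W] [Module E W] [Module E₀ W] [IsScalarTower E₀ E W] {n : ℕ}

/-- Conjugate linearity of an `E₀`-linear operator on `S^±`. -/
def IsConjLinear (σ : E ≃ₐ[E₀] E) (e : Module.Basis (Fin n ⊕ Fin n) E W) (ε : ZMod 2)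
    (L : Module.End E₀ (S e ε)) : Prop :=
  ∀ (c : E) (x : S e ε), L (c • x) = σ c • L x

/-- On `⋀^k W₁` the operator `L` is `(-1)^d lam^{-d} ⋆`, with `d = ⌊(k - m) / 2⌋`. Here `⋆` is the
conjugate linear Hodge operator `⋀^k W₁ → ⋀^{n-k} W₁` of `ψ` restricted to `W₁` and the volume form
`e_1 ∧ ⋯ ∧ e_n`, i.e. `u ∧ ⋆v = ψ(u, v) e_1 ∧ ⋯ ∧ e_n` for `u, v ∈ ⋀^k W₁`, where
`ψ(u_1 ∧ ⋯ ∧ u_k, v_1 ∧ ⋯ ∧ v_k) = det (ψ(u_i, v_j))`. -/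
def IsRescaledStar (ψ : W →ₗ[E₀] W →ₗ[E₀] E) (e : Module.Basis (Fin n ⊕ Fin n) E W)
    (lam : E₀) (m : ℕ) (ε : ZMod 2) (L : Module.End E₀ (S e ε)) : Prop :=
  ∀ (k : ℕ) (v : Fin k → W₁ e) (hv : ExteriorAlgebra.ιMulti E k v ∈ S e ε),
    (L ⟨_, hv⟩ : ExteriorAlgebra E (W₁ e)) ∈ ⋀[E]^(n - k) (W₁ e) ∧
    ∀ u : Fin k → W₁ e,
      ExteriorAlgebra.ιMulti E k u * (L ⟨_, hv⟩ : ExteriorAlgebra E (W₁ e)) =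
        (algebraMap E₀ E ((-1) ^ (((k : ℤ) - m) / 2) * lam ^ (-(((k : ℤ) - m) / 2))) *
          (Matrix.of fun i j => ψ (u i) (v j)).det) • ExteriorAlgebra.ιMulti E n (e₁ e)

end Operators

end HalfSpin

end

/-! The pair b, ψ is encoded by a conjugate-linear map J of W with b(z, Jw) = ψ(z, w). Compatibility
of the forms gives J² = λ and b(Jz, Jw) = λ σ(b(z, w)), and every automorphism preserving b and ψ
commutes with J. Over a field K containing r = √λ, the map r⁻¹J respects the Clifford relations up
to conjugation, so it extends to a conjugate-linear involution T of C ⊗ K (`exists_isTwist`). If g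
lies over an automorphism preserving b and ψ, then g and T(g) induce the same map of W ⊗ K. Hence
g⁻¹T(g) is even and commutes with all vectors, so it is a scalar, and compatibility of T with
reversal forces it to be ±1 (`IsTwist.eq_or_eq_neg`). The sign cannot change on a Zariski-connected
set, so T fixes G₁ (`IsTwist.eq_of_mem_G₁`).

It remains to realise T on spinors. The space ⋀W₁ is generated from 1 by W₁, the vector 1 is killed
by W₂, and J exchanges W₁ and W₂. So there is a conjugate-linear L sending 1 to a multiple of the
volume element and carrying the action of w to that of Jw, up to a factor s on even and t on odd
elements with stλ = 1 (`exists_isIntertwiner`). On products of two vectors the factors combine to st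
= λ⁻¹ = r⁻², whence L g = T(g) L for even g, and L commutes with G₁.

Since L turns wedging with v into contraction with Jv, Laplace expansion of a determinant identifies
it with a rescaled Hodge star (`IsIntertwiner.ιMulti_mul`); the coefficients (-1)^d λ^{-d}
correspond to one choice of s and t. Finally L² is a scalar on each parity (`IsIntertwiner.sq`),
determined by L(L 1), which is read off from degrees 0 and n. -/

noncomputable section

namespace HalfSpin

/-! ### Clifford algebras: semilinear lifts, contractions and their common kernel. -/

section Clifford

/-- The universal property of the Clifford algebra for semilinear maps: the values lie in a ring in
which the scalars act through a ring homomorphism `φ` with central image. -/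
theorem exists_semilinear_lift {E W A : Type*} [CommRing E] [AddCommGroup W] [Module E W] [Ring A]
    (Q : QuadraticForm E W) (φ : E →+* A) (hφ : ∀ c x, φ c * x = x * φ c) (f : W →+ A)
    (hf : ∀ c w, f (c • w) = φ c * f w) (hQ : ∀ w, f w * f w = φ (Q w)) :
    ∃ F : CliffordAlgebra Q →+* A, (∀ c, F (algebraMap E _ c) = φ c) ∧
      ∀ w, F (CliffordAlgebra.ι Q w) = f w := by
  let alg : Algebra E A := φ.toAlgebra' hφ
  let f' : W →ₗ[E] A :=
    { f with map_smul' := fun c w => (hf c w).trans (Algebra.smul_def c (f w)).symm }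
  have hf' : ∀ w, f' w * f' w = algebraMap E A (Q w) := hQ
  let F : CliffordAlgebra Q →ₐ[E] A := CliffordAlgebra.lift Q ⟨f', hf'⟩
  have h1 : ∀ c, F (algebraMap E _ c) = algebraMap E A c := fun c => F.commutes c
  have h2 : ∀ w, F (CliffordAlgebra.ι Q w) = f' w :=
    fun w => CliffordAlgebra.lift_ι_apply f' hf' w
  exact ⟨F.toRingHom, h1, h2⟩

variable {E W : Type*} [Field E] [AddCommGroup W] [Module E W]

theorem ringHom_ext {A : Type*} [Semiring A] {Q : QuadraticForm E W}
    {F G : CliffordAlgebra Q →+* A}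
    (h1 : ∀ c, F (algebraMap E _ c) = G (algebraMap E _ c))
    (h2 : ∀ w, F (CliffordAlgebra.ι Q w) = G (CliffordAlgebra.ι Q w)) : F = G := by
  refine RingHom.ext fun x => ?_
  induction x using CliffordAlgebra.induction with
  | algebraMap r => exact h1 r
  | ι w => exact h2 w
  | mul x y hx hy => rw [map_mul, map_mul, hx, hy]
  | add x y hx hy => rw [map_add, map_add, hx, hy]

/-- Contraction is an antiderivation: moving it past each vector of x costs one sign, and the signs
are collected by `involute`. -/
theorem contractLeft_mul (Q : QuadraticForm E W) (d : Module.Dual E W) (x y : CliffordAlgebra Q) :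
    CliffordAlgebra.contractLeft d (x * y) =
      CliffordAlgebra.contractLeft d x * y +
        CliffordAlgebra.involute x * CliffordAlgebra.contractLeft d y := by
  induction x using CliffordAlgebra.left_induction generalizing y with
  | algebraMap r =>
    simp [CliffordAlgebra.contractLeft_algebraMap_mul, CliffordAlgebra.contractLeft_algebraMap]
  | add x z hx hz => simp only [add_mul, map_add, hx, hz]; abel
  | ι_mul x v hx =>
    rw [mul_assoc, CliffordAlgebra.contractLeft_ι_mul, hx, CliffordAlgebra.contractLeft_ι_mul,
      map_mul, CliffordAlgebra.involute_ι]
    simp only [mul_add, sub_mul, neg_mul, smul_mul_assoc, mul_assoc]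
    abel

/-- The factor 1/2 in `quad` makes its polar form equal to b. -/
theorem ι_mul_ι_add_comm [CharZero E] {b : LinearMap.BilinForm E W}
    (hb : ∀ z w, b z w = b w z) (z w : W) :
    CliffordAlgebra.ι (quad b) z * CliffordAlgebra.ι (quad b) w +
      CliffordAlgebra.ι (quad b) w * CliffordAlgebra.ι (quad b) z = algebraMap E _ (b z w) := by
  rw [CliffordAlgebra.ι_mul_ι_add_swap]
  congr 1
  simp only [QuadraticMap.polar, quad, smul_apply, LinearMap.BilinMap.toQuadraticMap_apply,
    map_add, LinearMap.add_apply, smul_eq_mul, hb w z]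
  field_simp
  ring

/-- The graded commutator with v is an antiderivation with value b(v, u) on a vector u, and so is
contraction by b(v, ·). This turns statements about commuting with vectors into statements about
kernels of contractions. -/
theorem ι_mul_sub_involute_mul_ι [CharZero E] {b : LinearMap.BilinForm E W}
    (hb : ∀ z w, b z w = b w z) (v : W) (x : CliffordAlgebra (quad b)) :
    CliffordAlgebra.ι (quad b) v * x - CliffordAlgebra.involute x * CliffordAlgebra.ι (quad b) v =
      CliffordAlgebra.contractLeft (b v) x := by
  have hp : ∀ u, CliffordAlgebra.ι (quad b) v * CliffordAlgebra.ι (quad b) u =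
      algebraMap E _ (b v u) - CliffordAlgebra.ι (quad b) u * CliffordAlgebra.ι (quad b) v :=
    fun u => eq_sub_of_add_eq (ι_mul_ι_add_comm hb v u)
  induction x using CliffordAlgebra.left_induction with
  | algebraMap r =>
    rw [CliffordAlgebra.contractLeft_algebraMap, AlgHom.commutes, Algebra.commutes, sub_self]
  | add x z hx hz => rw [map_add, map_add, ← hx, ← hz, mul_add, add_mul]; abel
  | ι_mul x u hx =>
    rw [CliffordAlgebra.contractLeft_ι_mul, ← hx, map_mul, CliffordAlgebra.involute_ι, ← mul_assoc,
      hp, sub_mul, mul_sub, Algebra.smul_def]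
    simp only [neg_mul, mul_assoc]
    abel

/-- The operator Σ eᵢ ∧ (eᵢ* ⌟ ·) multiplies degree k by k. It kills x, so in characteristic zero x
has no component of positive degree. -/
theorem exists_algebraMap_of_contractLeft_exterior {ι : Type*} [Fintype ι] [DecidableEq ι]
    [CharZero E] (e : Module.Basis ι E W) (x : ExteriorAlgebra E W)
    (hx : ∀ i, CliffordAlgebra.contractLeft (e.coord i) x = 0) :
    ∃ c, x = algebraMap E _ c := by
  let N : ExteriorAlgebra E W →ₗ[E] ExteriorAlgebra E W :=
    ∑ i, LinearMap.mulLeft E (ExteriorAlgebra.ι E (e i)) ∘ₗ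
      CliffordAlgebra.contractLeft (Q := (0 : QuadraticForm E W)) (e.coord i)
  have hN : ∀ x, N x = ∑ i, ExteriorAlgebra.ι E (e i) *
      CliffordAlgebra.contractLeft (Q := (0 : QuadraticForm E W)) (e.coord i) x := by
    intro x
    simp [N, LinearMap.sum_apply]
  -- Euler's identity: wedging with a vector raises the eigenvalue of N by one.
  have hι : ∀ v y, N (ExteriorAlgebra.ι E v * y) =
      ExteriorAlgebra.ι E v * y + ExteriorAlgebra.ι E v * N y := by
    intro v y
    have h1 : ∀ i, ExteriorAlgebra.ι E (e i) * CliffordAlgebra.contractLeft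
        (Q := (0 : QuadraticForm E W)) (e.coord i) (ExteriorAlgebra.ι E v * y) =
        (ExteriorAlgebra.ι E (e.repr v i • e i)) * y + ExteriorAlgebra.ι E v *
          (ExteriorAlgebra.ι E (e i) * CliffordAlgebra.contractLeft
            (Q := (0 : QuadraticForm E W)) (e.coord i) y) := by
      intro i
      have h2 := CliffordAlgebra.contractLeft_ι_mul (Q := (0 : QuadraticForm E W))
        (d := e.coord i) v y
      have h3 := ExteriorAlgebra.ι_add_mul_swap (R := E) (e i) v
      refine (congrArg _ h2).trans ?_
      rw [mul_sub, ← mul_assoc, ← mul_assoc]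
      change _ - ExteriorAlgebra.ι E (e i) * ExteriorAlgebra.ι E v * _ = _
      rw [eq_neg_of_add_eq_zero_left h3]
      simp
    rw [hN, Finset.sum_congr rfl fun i _ => h1 i, Finset.sum_add_distrib, ← Finset.sum_mul,
      ← Finset.mul_sum, ← hN, ← map_sum, e.sum_repr]
  have hk : ∀ k : ℕ, ∀ y ∈ ⋀[E]^k W, N y = (k : E) • y := by
    intro k
    induction k with
    | zero =>
      intro y hy
      obtain ⟨r, rfl⟩ := Submodule.mem_one.mp (by simpa using hy)
      have : ∀ d, CliffordAlgebra.contractLeft d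
        (algebraMap E (CliffordAlgebra (0 : QuadraticForm E W)) r) = 0 :=
        fun d => CliffordAlgebra.contractLeft_algebraMap _ d r
      rw [hN]
      refine (Finset.sum_eq_zero fun i _ => ?_).trans (by simp)
      exact (congrArg _ (this _)).trans (mul_zero _)
    | succ k ih =>
      intro y hy
      replace hy : y ∈ LinearMap.range (ExteriorAlgebra.ι E (M := W)) * ⋀[E]^k W := by
        rw [← pow_succ']
        exact hy
      refine Submodule.mul_induction_on hy ?_ ?_
      · rintro _ ⟨v, rfl⟩ z hz
        rw [hι, ih z hz, mul_smul_comm]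
        push_cast
        rw [add_smul, one_smul, add_comm]
      · intro y z hy hz
        rw [map_add, hy, hz, smul_add]
  have hx0 : N x = 0 := by
    rw [hN]
    exact Finset.sum_eq_zero fun i _ => (congrArg _ (hx i)).trans (mul_zero _)
  let D := DirectSum.decompose (fun k : ℕ => ⋀[E]^k W)
  have hcomp : ∀ k : ℕ, ∀ y, ((D (N y)) k : ExteriorAlgebra E W) = (k : E) • (D y k : _) := by
    intro k y
    induction y using DirectSum.Decomposition.inductionOn (fun k : ℕ => ⋀[E]^k W) with
    | zero => simp [D]
    | homogeneous y =>
      rename_i j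
      rw [hk j y y.2]
      by_cases hjk : j = k
      · subst hjk
        simp only [D]
        rw [← Submodule.coe_smul, DirectSum.decompose_coe, DirectSum.decompose_coe,
          DirectSum.of_eq_same, DirectSum.of_eq_same]
        rfl
      · simp only [D]
        rw [← Submodule.coe_smul, DirectSum.decompose_coe, DirectSum.decompose_coe,
          DirectSum.of_eq_of_ne _ _ _ (Ne.symm hjk), DirectSum.of_eq_of_ne _ _ _ (Ne.symm hjk)]
        simp
    | add y z hy hz =>
      simp only [D, map_add, DirectSum.decompose_add, DirectSum.add_apply, Submodule.coe_add,
        smul_add] at *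
      rw [hy, hz]
  have hD : ∀ k : ℕ, k ≠ 0 → (D x k : ExteriorAlgebra E W) = 0 := by
    intro k hk0
    have h := hcomp k x
    rw [hx0] at h
    simp only [D, DirectSum.decompose_zero, DirectSum.zero_apply, ZeroMemClass.coe_zero] at h
    exact (smul_eq_zero.mp h.symm).resolve_left (by exact_mod_cast hk0)
  classical
  have hx1 : x ∈ ⋀[E]^0 W := by
    rw [← DirectSum.sum_support_decompose (fun k : ℕ => ⋀[E]^k W) x]
    refine Submodule.sum_mem _ fun k _ => ?_
    by_cases hk0 : k = 0
    · subst hk0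
      exact SetLike.coe_mem _
    · exact (hD k hk0 : _) ▸ Submodule.zero_mem _
  obtain ⟨r, hr⟩ := Submodule.mem_one.mp (by simpa using hx1)
  exact ⟨r, hr.symm⟩

/-- The linear isomorphism with the exterior algebra commutes with contractions and fixes scalars,
so the exterior case transfers. -/
theorem exists_algebraMap_of_contractLeft {ι : Type*} [Fintype ι] [DecidableEq ι]
    [CharZero E] (Q : QuadraticForm E W) (e : Module.Basis ι E W) (x : CliffordAlgebra Q)
    (hx : ∀ i, CliffordAlgebra.contractLeft (e.coord i) x = 0) :
    ∃ c, x = algebraMap E _ c := by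
  let _ : Invertible (2 : E) := invertibleOfNonzero two_ne_zero
  obtain ⟨c, hc⟩ := exists_algebraMap_of_contractLeft_exterior e (CliffordAlgebra.equivExterior Q x)
    fun i => by
      have := CliffordAlgebra.changeForm_contractLeft
        (h := CliffordAlgebra.changeForm.associated_neg_proof (Q := Q)) (e.coord i) x
      exact this.symm.trans ((congrArg _ (hx i)).trans (map_zero _))
  refine ⟨c, (CliffordAlgebra.equivExterior Q).injective (hc.trans ?_)⟩
  exact (CliffordAlgebra.changeForm_algebraMap
    (h := CliffordAlgebra.changeForm.associated_neg_proof (Q := Q)) c).symm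

theorem finite_cliffordAlgebra {ι : Type*} [Finite ι] [CharZero E] (Q : QuadraticForm E W)
    (e : Module.Basis ι E W) : Module.Finite E (CliffordAlgebra Q) := by
  let _ : Invertible (2 : E) := invertibleOfNonzero two_ne_zero
  have := Fintype.ofFinite ι
  let _ : LinearOrder ι := IsWellOrder.linearOrder WellOrderingRel
  have : Module.Finite E (ExteriorAlgebra E W) := Module.Finite.of_basis e.ExteriorAlgebra
  exact Module.Finite.equiv (CliffordAlgebra.equivExterior Q).symm

end Clifford

/-! ### The conjugate-linear similitude J attached to b and ψ. -/

section ConjMap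

/-- J and ψ are bundled only as E₀-linear maps, so extensionality along an E-basis does not apply to
them directly; this induction replaces it. -/
theorem basis_induction {ι R M : Type*} [Ring R] [AddCommGroup M] [Module R M]
    (e : Module.Basis ι R M) {p : M → Prop} (zero : p 0) (add : ∀ x y, p x → p y → p (x + y))
    (smul : ∀ (c : R) x, p x → p (c • x)) (basis : ∀ i, p (e i)) (x : M) : p x := by
  have hx : x ∈ Submodule.span R (Set.range e) := by simp [e.span_eq]
  refine Submodule.span_induction (p := fun x _ => p x) ?_ zero (fun x y _ _ => add x y)
    (fun c x _ => smul c x) hx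
  rintro _ ⟨i, rfl⟩
  exact basis i

variable {E₀ E W : Type*} [Field E₀] [Field E] [Algebra E₀ E]
  [AddCommGroup W] [Module E W] [Module E₀ W] [IsScalarTower E₀ E W] {n : ℕ}

/-- A conjugate linear similitude of `b` with square and multiplier `lam`. -/
structure IsConjSimilitude (σ : E ≃ₐ[E₀] E) (b : LinearMap.BilinForm E W) (lam : E₀)
    (J : W →ₗ[E₀] W) : Prop where
  smul : ∀ (c : E) (w : W), J (c • w) = σ c • J w
  sq : ∀ w, J (J w) = lam • w
  form : ∀ z w, b (J z) (J w) = algebraMap E₀ E lam * σ (b z w)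

/-- The conjugate linear map with `e_i ↦ a_i e_{n+i}` and `e_{n+i} ↦ a_{n+i} e_i`. -/
def conjMap (σ : E ≃ₐ[E₀] E) (e : Module.Basis (Fin n ⊕ Fin n) E W) (a : Fin n ⊕ Fin n → E₀) :
    W →ₗ[E₀] W where
  toFun w := ∑ r, (σ (e.repr w r) * algebraMap E₀ E (a r)) • e r.swap
  map_add' z w := by
    simp [add_mul, add_smul, Finset.sum_add_distrib]
  map_smul' c w := by
    rw [← algebraMap_smul E c w, RingHom.id_apply, ← algebraMap_smul E c, Finset.smul_sum]
    simp only [map_smul, Finsupp.smul_apply, smul_eq_mul, map_mul, AlgEquiv.commutes, smul_smul,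
      mul_assoc]

variable {σ : E ≃ₐ[E₀] E} {e : Module.Basis (Fin n ⊕ Fin n) E W} {a : Fin n ⊕ Fin n → E₀}
  {b : LinearMap.BilinForm E W} {ψ : W →ₗ[E₀] W →ₗ[E₀] E} {lam : E₀}

theorem conjMap_apply (w : W) :
    conjMap σ e a w = ∑ r, (σ (e.repr w r) * algebraMap E₀ E (a r)) • e r.swap := rfl

theorem conjMap_basis (r : Fin n ⊕ Fin n) : conjMap σ e a (e r) = a r • e r.swap := by
  rw [conjMap_apply, Finset.sum_eq_single r]
  · simp
  · intro s _ hs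
    simp [Finsupp.single_eq_of_ne hs]
  · simp

theorem conjMap_smul (c : E) (w : W) : conjMap σ e a (c • w) = σ c • conjMap σ e a w := by
  simp [conjMap_apply, Finset.smul_sum, smul_smul, mul_assoc]

theorem IsHyperbolicBasis.form_basis (hb : IsHyperbolicBasis b e) (r s : Fin n ⊕ Fin n) :
    b (e r) (e s) = if r = s.swap then 1 else 0 := by
  rcases r with i | i <;> rcases s with j | j <;>
    simp [hb.inl_inl, hb.inl_inr, hb.inr_inl, hb.inr_inr]

theorem IsGoodBasis.mul_swap (he : IsGoodBasis b ψ e a lam) (r : Fin n ⊕ Fin n) :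
    a r * a r.swap = lam := by
  rcases r with i | i
  · exact he.mul_eq i
  · rw [mul_comm]
    exact he.mul_eq i

theorem IsHermitianForm.smul_right (hψ : IsHermitianForm σ ψ) (c : E) (z w : W) :
    ψ z (c • w) = σ c * ψ z w := by
  rw [← hψ.conj_symm, hψ.smul_left, map_mul, hψ.conj_symm]

/-- Both sides are linear in z and conjugate linear in w, and on basis vectors both equal a_s if r =
s and 0 otherwise. This identity characterises J. -/
theorem form_conjMap (hψ : IsHermitianForm σ ψ) (he : IsGoodBasis b ψ e a lam) (z w : W) :
    b z (conjMap σ e a w) = ψ z w := by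
  have h1 : ∀ r s, b (e r) (conjMap σ e a (e s)) = ψ (e r) (e s) := by
    intro r s
    rw [conjMap_basis, he.diagonal, ← algebraMap_smul E, map_smul, he.hyperbolic.form_basis,
      Sum.swap_swap]
    split_ifs with h
    · simp [h]
    · simp
  have h2 : ∀ z s, b z (conjMap σ e a (e s)) = ψ z (e s) := by
    intro z s
    induction z using basis_induction e with
    | zero => simp
    | add z w hz hw => simp [hz, hw]
    | smul c z hz => rw [map_smul, LinearMap.smul_apply, hz, hψ.smul_left, smul_eq_mul]
    | basis r => exact h1 r s
  induction w using basis_induction e with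
  | zero => simp
  | add v w hv hw => simp [hv, hw]
  | smul c w hw => rw [conjMap_smul, map_smul, hw, hψ.smul_right, smul_eq_mul]
  | basis s => exact h2 z s

/-- Compatibility enters here: J² multiplies e_i and e_{n+i} by a_i a_{n+i} = λ. -/
theorem conjMap_conjMap (hσ2 : ∀ c, σ (σ c) = c) (he : IsGoodBasis b ψ e a lam) (w : W) :
    conjMap σ e a (conjMap σ e a w) = lam • w := by
  induction w using basis_induction e with
  | zero => simp
  | add v w hv hw => rw [map_add, map_add, hv, hw, smul_add]
  | smul c w hw => rw [conjMap_smul, conjMap_smul, hσ2, hw, smul_comm]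
  | basis r => rw [conjMap_basis, map_smul, conjMap_basis, smul_smul, he.mul_swap, Sum.swap_swap]

/-- For the multiplier: b(Jz, Jw) = ψ(Jz, w) = σ(ψ(w, Jz)) = σ(b(w, J²z)) = λ σ(b(z, w)). -/
theorem isConjSimilitude_conjMap (hσ2 : ∀ c, σ (σ c) = c) (hψ : IsHermitianForm σ ψ)
    (he : IsGoodBasis b ψ e a lam) : IsConjSimilitude σ b lam (conjMap σ e a) where
  smul := conjMap_smul
  sq := conjMap_conjMap hσ2 he
  form z w := by
    rw [form_conjMap hψ he, ← hψ.conj_symm, ← form_conjMap hψ he, conjMap_conjMap hσ2 he,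
      ← algebraMap_smul E, map_smul, smul_eq_mul, map_mul, AlgEquiv.commutes,
      form_symm he.hyperbolic]

end ConjMap

/-! ### The grading of ⋀W₁ and its interaction with the action of vectors. -/

section Parity

variable {E W : Type*} [Field E] [AddCommGroup W] [Module E W] {n : ℕ}
  {b : LinearMap.BilinForm E W} {e : Module.Basis (Fin n ⊕ Fin n) E W}

theorem involute_contractLeft {Q : QuadraticForm E W} (d : Module.Dual E W)
    (x : CliffordAlgebra Q) :
    CliffordAlgebra.involute (CliffordAlgebra.contractLeft d x) =
      -CliffordAlgebra.contractLeft d (CliffordAlgebra.involute x) := by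
  induction x using CliffordAlgebra.left_induction with
  | algebraMap r => simp [CliffordAlgebra.contractLeft_algebraMap]
  | add x z hx hz => simp only [map_add, hx, hz, neg_add]
  | ι_mul x v hx =>
    simp only [CliffordAlgebra.contractLeft_ι_mul, map_mul, CliffordAlgebra.involute_ι, neg_mul,
      map_neg, map_sub, map_smul, hx]
    simp

/-- The grading involution of the exterior algebra of `W₁`. -/
def parity (e : Module.Basis (Fin n ⊕ Fin n) E W) : Module.End E (ExteriorAlgebra E (W₁ e)) :=
  (CliffordAlgebra.involute (Q := (0 : QuadraticForm E (W₁ e)))).toLinearMap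

theorem parity_one : parity e 1 = 1 := map_one (CliffordAlgebra.involute
  (Q := (0 : QuadraticForm E (W₁ e))))

theorem parity_ι_mul (v : W₁ e) (x : ExteriorAlgebra E (W₁ e)) :
    parity e (ExteriorAlgebra.ι E v * x) = -(ExteriorAlgebra.ι E v * parity e x) := by
  refine (map_mul (CliffordAlgebra.involute (Q := (0 : QuadraticForm E (W₁ e)))) _ _).trans ?_
  rw [← neg_mul]
  exact congrArg (· * _) (CliffordAlgebra.involute_ι v)

theorem parity_parity (x : ExteriorAlgebra E (W₁ e)) : parity e (parity e x) = x :=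
  CliffordAlgebra.involute_involute x

theorem parity_vectorAction (w : W) (x : ExteriorAlgebra E (W₁ e)) :
    parity e (vectorAction b e w x) = -vectorAction b e w (parity e x) := by
  rw [vectorAction_apply, vectorAction_apply, map_add, parity_ι_mul, neg_add]
  exact congrArg _ (involute_contractLeft _ x)

theorem parity_induction [CharZero E] {p : ExteriorAlgebra E (W₁ e) → Prop}
    (hadd : ∀ x y, p x → p y → p (x + y)) (heven : ∀ x, parity e x = x → p x)
    (hodd : ∀ x, parity e x = -x → p x) (x : ExteriorAlgebra E (W₁ e)) : p x := by
  have h : x = (2⁻¹ : E) • (x + parity e x) + (2⁻¹ : E) • (x - parity e x) := by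
    rw [← smul_add, add_add_sub_cancel, ← two_smul E x, smul_smul, inv_mul_cancel₀ two_ne_zero,
      one_smul]
  rw [h]
  refine hadd _ _ (heven _ ?_) (hodd _ ?_)
  · rw [map_smul, map_add, parity_parity, add_comm]
  · rw [map_smul, map_sub, parity_parity, ← smul_neg, neg_sub]

/-- The operator which is `s` on even elements and `t` on odd elements. -/
def parityScale (e : Module.Basis (Fin n ⊕ Fin n) E W) (s t : E) :
    Module.End E (ExteriorAlgebra E (W₁ e)) :=
  ((s + t) / 2) • 1 + ((s - t) / 2) • parity e

theorem parityScale_even [CharZero E] (s t : E) {x : ExteriorAlgebra E (W₁ e)}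
    (hx : parity e x = x) : parityScale e s t x = s • x := by
  rw [parityScale, LinearMap.add_apply, LinearMap.smul_apply, LinearMap.smul_apply, hx,
    Module.End.one_apply, ← add_smul]
  congr 1
  ring

theorem parityScale_odd [CharZero E] (s t : E) {x : ExteriorAlgebra E (W₁ e)}
    (hx : parity e x = -x) : parityScale e s t x = t • x := by
  rw [parityScale, LinearMap.add_apply, LinearMap.smul_apply, LinearMap.smul_apply, hx,
    Module.End.one_apply, smul_neg, ← sub_eq_add_neg, ← sub_smul]
  congr 1
  ring

/-- Vectors reverse parity, so the two factors trade places. Consequently two vectors in succession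
pick up st on either parity. -/
theorem parityScale_vectorAction [CharZero E] (s t : E) (w : W) (x : ExteriorAlgebra E (W₁ e)) :
    parityScale e s t (vectorAction b e w x) = vectorAction b e w (parityScale e t s x) := by
  induction x using parity_induction with
  | hadd x y hx hy => simp only [map_add, hx, hy]
  | heven x hx =>
    rw [parityScale_even t s hx, parityScale_odd s t (by rw [parity_vectorAction, hx]), map_smul]
  | hodd x hx =>
    rw [parityScale_odd t s hx, parityScale_even s t (by rw [parity_vectorAction, hx, map_neg,
      neg_neg]), map_smul]

theorem parityScale_parityScale [CharZero E] (s t s' t' : E) (x : ExteriorAlgebra E (W₁ e)) :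
    parityScale e s t (parityScale e s' t' x) = parityScale e (s * s') (t * t') x := by
  induction x using parity_induction with
  | hadd x y hx hy => simp only [map_add, hx, hy]
  | heven x hx =>
    rw [parityScale_even _ _ hx, parityScale_even _ _ hx, map_smul, parityScale_even _ _ hx,
      smul_smul, mul_comm]
  | hodd x hx =>
    rw [parityScale_odd _ _ hx, parityScale_odd _ _ hx, map_smul, parityScale_odd _ _ hx,
      smul_smul, mul_comm]

theorem parityScale_self [CharZero E] (s : E) (x : ExteriorAlgebra E (W₁ e)) :
    parityScale e s s x = s • x := by
  simp [parityScale]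

theorem parity_parityScale (s t : E) (x : ExteriorAlgebra E (W₁ e)) :
    parity e (parityScale e s t x) = parityScale e s t (parity e x) := by
  simp [parityScale]

/-- Polarisation of `vectorAction_mul_self`. -/
theorem vectorAction_comm [CharZero E] (hb : IsHyperbolicBasis b e) (z w : W)
    (x : ExteriorAlgebra E (W₁ e)) :
    vectorAction b e z (vectorAction b e w x) + vectorAction b e w (vectorAction b e z x) =
      b z w • x := by
  have h : ∀ w, vectorAction b e w (vectorAction b e w x) = ((2⁻¹ : E) * b w w) • x := fun w =>
    congrArg (fun f : Module.End E (ExteriorAlgebra E (W₁ e)) => f x) (vectorAction_mul_self hb w)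
  have h1 := h (z + w)
  simp only [map_add, LinearMap.add_apply, h z, h w, mul_add, add_smul, form_symm hb w z] at h1
  have h2 : ((2⁻¹ : E) * b z w) • x + ((2⁻¹ : E) * b z w) • x = b z w • x := by
    rw [← add_smul]
    congr 1
    ring
  rw [← h2]
  have h3 : ∀ p q r s u : ExteriorAlgebra E (W₁ e), p + q + (r + s) = p + u + (u + s) →
      r + q = u + u := by
    intro p q r s u h
    have h' : p + s + (r + q) = p + s + (u + u) := by
      refine Eq.trans ?_ (h.trans ?_) <;> abel
    exact add_left_cancel h'
  exact h3 _ _ _ _ _ h1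

theorem proj₁_W₁ (w : W₁ e) : proj₁ e (w : W) = w := by
  obtain ⟨w, hw⟩ := w
  have h : ∀ w ∈ W₁ e, ((proj₁ e w : W₁ e) : W) = w := by
    intro w hw
    refine Submodule.span_induction (p := fun w _ => ((proj₁ e w : W₁ e) : W) = w) ?_ ?_ ?_ ?_ hw
    · rintro _ ⟨i, rfl⟩
      exact proj₁_inl i
    · simp
    · intro z w _ _ hz hw
      rw [map_add, Submodule.coe_add, hz, hw]
    · intro c w _ hw
      rw [map_smul, Submodule.coe_smul, hw]
  exact Subtype.ext (h w hw)

theorem form_W₁ (hb : IsHyperbolicBasis b e) (z w : W₁ e) : b (z : W) w = 0 := by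
  have h := form_proj₁ hb (z : W) w
  rw [proj₁_W₁, proj₁_W₁] at h
  simpa using h

theorem vectorAction_W₁ (hb : IsHyperbolicBasis b e) (w : W₁ e) (x : ExteriorAlgebra E (W₁ e)) :
    vectorAction b e (w : W) x = ExteriorAlgebra.ι E w * x := by
  have h : LinearMap.compl₂ b (W₁ e).subtype (w : W) = 0 := by
    ext z
    exact form_W₁ hb w z
  rw [vectorAction_apply, proj₁_W₁, h, map_zero, LinearMap.zero_apply, add_zero]

theorem vectorAction_of_proj₁_eq_zero {w : W} (hw : proj₁ e w = 0)
    (x : ExteriorAlgebra E (W₁ e)) : vectorAction b e w x =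
      CliffordAlgebra.contractLeft (LinearMap.compl₂ b (W₁ e).subtype w) x := by
  rw [vectorAction_apply, hw, map_zero, zero_mul, zero_add]

end Parity

/-! ### Conjugate-linear intertwiners on ⋀W₁. -/

section ConjOperator

variable {E₀ E W : Type*} [Field E₀] [Field E] [Algebra E₀ E] [CharZero E]
  [AddCommGroup W] [Module E W] [Module E₀ W] [IsScalarTower E₀ E W] {n : ℕ}
  {σ : E ≃ₐ[E₀] E} {e : Module.Basis (Fin n ⊕ Fin n) E W} {a : Fin n ⊕ Fin n → E₀}
  {b : LinearMap.BilinForm E W} {ψ : W →ₗ[E₀] W →ₗ[E₀] E} {lam : E₀} {J : W →ₗ[E₀] W}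

/-- `L` is a conjugate linear operator on `⋀ W₁` which preserves parity and intertwines the action
of `w` with the action of `J w`, up to the factor `s` on even and `t` on odd elements. -/
structure IsIntertwiner (σ : E ≃ₐ[E₀] E) (b : LinearMap.BilinForm E W)
    (e : Module.Basis (Fin n ⊕ Fin n) E W) (J : W →ₗ[E₀] W) (s t : E)
    (L : ExteriorAlgebra E (W₁ e) →ₗ[E₀] ExteriorAlgebra E (W₁ e)) : Prop where
  smul : ∀ (c : E) x, L (c • x) = σ c • L x
  map_vectorAction : ∀ w x, L (vectorAction b e w x) = vectorAction b e (J w) (parityScale e s t (L x))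
  map_parity : ∀ x, L (parity e x) = parity e (L x)

/-- L is forced to be x ↦ F(x) v₀, where F is the semilinear multiplicative extension of w ↦ (action
of Jw) ∘ `parityScale`. Compatibility with W₁ is then built in. For W₂ it holds on scalars because J
W₂ ⊆ W₁ kills v₀, and it propagates by the Clifford relation, where stλ = 1 is exactly what is
needed. -/
theorem exists_isIntertwiner (hb : IsHyperbolicBasis b e) (hJ : IsConjSimilitude σ b lam J)
    (hJ₂ : ∀ w, proj₁ e w = 0 → J w ∈ W₁ e) {s t : E} (hst : s * t * algebraMap E₀ E lam = 1)
    (v₀ : ExteriorAlgebra E (W₁ e)) (hv₀ : parity e v₀ = v₀)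
    (hv₁ : ∀ w : W₁ e, vectorAction b e w v₀ = 0) :
    ∃ L, IsIntertwiner σ b e J s t L ∧ L 1 = v₀ := by
  let Λ := ExteriorAlgebra E (W₁ e)
  let f : W₁ e →+ Module.End E Λ :=
    { toFun := fun w => vectorAction b e (J w) * parityScale e s t
      map_zero' := by simp
      map_add' := fun z w => by simp [add_mul] }
  have hf : ∀ w x, f w x = vectorAction b e (J w) (parityScale e s t x) := fun w x => rfl
  have hVV : ∀ z w x, vectorAction b e (J z) (parityScale e s t (vectorAction b e (J w)
      (parityScale e s t x))) = (s * t) • vectorAction b e (J z) (vectorAction b e (J w) x) := by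
    intro z w x
    rw [parityScale_vectorAction, parityScale_parityScale, mul_comm t s, parityScale_self, map_smul,
      map_smul]
  obtain ⟨F, hF1, hF2⟩ := exists_semilinear_lift (0 : QuadraticForm E (W₁ e))
    ((algebraMap E (Module.End E Λ)).comp (σ : E →+* E))
    (fun c x => Algebra.commutes (σ c) x) f
    (fun c w => by
      refine LinearMap.ext fun x => ?_
      change f (c • w) x = σ c • f w x
      rw [hf, hf, Submodule.coe_smul, hJ.smul, map_smul, LinearMap.smul_apply])
    (fun w => by
      refine LinearMap.ext fun x => ?_
      rw [Module.End.mul_apply, hf, hf, hVV]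
      -- For w in W₁ the vector Jw is again isotropic, so its action squares to zero, as the
      -- exterior algebra requires.
      have h := vectorAction_comm hb (J w) (J w) x
      rw [hJ.form, form_W₁ hb, map_zero, mul_zero, zero_smul, ← two_smul E, smul_eq_zero] at h
      rw [h.resolve_left two_ne_zero]
      simp)
  let L : Λ →ₗ[E₀] Λ :=
    { toFun := fun x => F x v₀
      map_add' := fun x y => by rw [map_add, LinearMap.add_apply]
      map_smul' := fun c x => by
        rw [← algebraMap_smul E c x, Algebra.smul_def, map_mul, hF1, RingHom.id_apply]
        change σ (algebraMap E₀ E c) • F x v₀ = _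
        rw [AlgEquiv.commutes, algebraMap_smul] }
  have hL : ∀ x, L x = F x v₀ := fun x => rfl
  have hsmul : ∀ (c : E) x, L (c • x) = σ c • L x := by
    intro c x
    rw [hL, Algebra.smul_def, map_mul, hF1]
    rfl
  have hL1 : L 1 = v₀ := by
    rw [hL, map_one, Module.End.one_apply]
  have hι : ∀ (w : W₁ e) x, L (ExteriorAlgebra.ι E w * x) =
      vectorAction b e (J w) (parityScale e s t (L x)) := by
    intro w x
    rw [hL, map_mul, Module.End.mul_apply, ← hL, ← hf]
    exact congrArg (fun g : Module.End E Λ => g (L x)) (hF2 w)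
  have hW₂ : ∀ w, proj₁ e w = 0 → ∀ x, L (vectorAction b e w x) =
      vectorAction b e (J w) (parityScale e s t (L x)) := by
    intro w hw x
    induction x using CliffordAlgebra.left_induction with
    | algebraMap r =>
      have h1 : vectorAction b e w (algebraMap E Λ r) = 0 := by
        rw [vectorAction_of_proj₁_eq_zero hw]
        exact CliffordAlgebra.contractLeft_algebraMap _ _ r
      have h2 : L (algebraMap E Λ r) = σ r • v₀ := by
        rw [Algebra.algebraMap_eq_smul_one, hsmul, hL1]
      refine (congrArg L h1).trans ((map_zero L).trans (Eq.symm ?_))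
      refine (congrArg (fun y => vectorAction b e (J w) (parityScale e s t y)) h2).trans ?_
      simp only [map_smul]
      rw [parityScale_even s t hv₀, map_smul, hv₁ ⟨J w, hJ₂ w hw⟩, smul_zero, smul_zero]
    | add x y hx hy => simp only [map_add, hx, hy]
    | ι_mul y u hy =>
      -- The anticommutators before and after L are b(w, u) and b(Jw, Ju) = λ σ(b(w, u)); the factor
      -- st brings the second back to σ(b(w, u)).
      have h1 := vectorAction_comm hb w u y
      rw [vectorAction_W₁ hb, vectorAction_W₁ hb] at h1
      have h2 := vectorAction_comm hb (J w) (J u) (L y)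
      rw [hJ.form] at h2
      change L (vectorAction b e w (ExteriorAlgebra.ι E u * y)) =
        vectorAction b e (J w) (parityScale e s t (L (ExteriorAlgebra.ι E u * y)))
      rw [eq_sub_of_add_eq h1, map_sub, hsmul, hι, hι, hy, hVV, hVV, eq_sub_of_add_eq h2, smul_sub,
        smul_smul, ← mul_assoc, hst, one_mul]
  refine ⟨L, ⟨hsmul, fun w x => ?_, fun x => ?_⟩, hL1⟩
  · have hw : w = (proj₁ e w : W) + (w - proj₁ e w) := by abel
    rw [hw, map_add (vectorAction b e), map_add J, LinearMap.add_apply, map_add L, map_add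
      (vectorAction b e), LinearMap.add_apply, hW₂ (w - proj₁ e w), vectorAction_W₁ hb, hι]
    rw [map_sub, proj₁_W₁, sub_self]
  · induction x using CliffordAlgebra.left_induction with
    | algebraMap r =>
      have h2 : L (algebraMap E Λ r) = σ r • v₀ := by
        rw [Algebra.algebraMap_eq_smul_one, hsmul, hL1]
      have h3 : parity e (algebraMap E Λ r) = algebraMap E Λ r := by
        rw [Algebra.algebraMap_eq_smul_one, map_smul, parity_one]
      refine (congrArg L h3).trans (h2.trans (Eq.symm ?_))
      refine (congrArg (parity e) h2).trans ?_
      rw [map_smul, hv₀]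
    | add x y hx hy => simp only [map_add, hx, hy]
    | ι_mul y u hy =>
      change L (parity e (ExteriorAlgebra.ι E u * y)) = parity e (L (ExteriorAlgebra.ι E u * y))
      rw [parity_ι_mul, map_neg, hι, hι, hy, parity_vectorAction, parity_parityScale]

theorem IsIntertwiner.map_parityScale {s t : E} {L : ExteriorAlgebra E (W₁ e) →ₗ[E₀] _}
    (hL : IsIntertwiner σ b e J s t L) (s' t' : E) (x : ExteriorAlgebra E (W₁ e)) :
    L (parityScale e s' t' x) = parityScale e (σ s') (σ t') (L x) := by
  induction x using parity_induction with
  | hadd x y hx hy => simp only [map_add, hx, hy]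
  | heven x hx =>
    rw [parityScale_even _ _ hx, parityScale_even _ _ (by rw [← hL.map_parity, hx]), hL.smul]
  | hodd x hx =>
    rw [parityScale_odd _ _ hx, parityScale_odd _ _ (by rw [← hL.map_parity, hx, map_neg]), hL.smul]

/-- The square of an intertwiner is a scalar on the even and on the odd part. -/
theorem IsIntertwiner.sq (hb : IsHyperbolicBasis b e) (hJ : IsConjSimilitude σ b lam J)
    (hσ2 : ∀ c, σ (σ c) = c) {s t : E₀} (hst : s * t * lam = 1)
    {L : ExteriorAlgebra E (W₁ e) →ₗ[E₀] _}
    (hL : IsIntertwiner σ b e J (algebraMap E₀ E s) (algebraMap E₀ E t) L) {q : E}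
    (h1 : L (L 1) = q • (1 : ExteriorAlgebra E (W₁ e))) (x : ExteriorAlgebra E (W₁ e)) :
    L (L x) = parityScale e q (algebraMap E₀ E (lam * s ^ 2) * q) x := by
  have hst' : algebraMap E₀ E s * algebraMap E₀ E t * algebraMap E₀ E lam = 1 := by
    rw [← map_mul, ← map_mul, hst, map_one]
  induction x using CliffordAlgebra.left_induction with
  | algebraMap r =>
    have h3 : parity e (algebraMap E (ExteriorAlgebra E (W₁ e)) r) = algebraMap E _ r := by
      rw [Algebra.algebraMap_eq_smul_one, map_smul, parity_one]
    refine Eq.trans ?_ (parityScale_even _ _ h3).symm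
    change L (L (algebraMap E (ExteriorAlgebra E (W₁ e)) r)) = _
    rw [Algebra.algebraMap_eq_smul_one, hL.smul, hL.smul, hσ2, h1, smul_comm]
  | add x y hx hy => simp only [map_add, hx, hy]
  | ι_mul y u hy =>
    change L (L (ExteriorAlgebra.ι E u * y)) =
      parityScale e _ _ (ExteriorAlgebra.ι E u * y)
    -- Passing L twice through u gives J²u = λu and the factors s², t². On even y this yields λs²q;
    -- on odd y it yields λt²·λs²q = (stλ)²q = q.
    rw [← vectorAction_W₁ hb, hL.map_vectorAction, hL.map_vectorAction, hL.map_parityScale, AlgEquiv.commutes,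
      AlgEquiv.commutes, parityScale_parityScale, hy, parityScale_parityScale,
      parityScale_vectorAction, hJ.sq, ← algebraMap_smul E lam, map_smul, LinearMap.smul_apply,
      ← map_smul, ← parityScale_self, parityScale_parityScale]
    congr 3
    · rw [map_mul, map_pow]
      ring
    · rw [map_mul, map_pow]
      linear_combination (algebraMap E₀ E s * algebraMap E₀ E t * algebraMap E₀ E lam + 1) * q *
        hst'

end ConjOperator

/-! ### Identification of the intertwiner with a rescaled Hodge star. -/

section Star

/-- The signs are those of a Laplace expansion along the first column, which is how the determinant
of ψ appears below. -/
theorem contractLeft_ιMulti {E M : Type*} [Field E] [AddCommGroup M] [Module E M]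
    (d : Module.Dual E M) (k : ℕ) (u : Fin (k + 1) → M) :
    CliffordAlgebra.contractLeft (Q := (0 : QuadraticForm E M)) d
      (ExteriorAlgebra.ιMulti E (k + 1) u) =
      ∑ j : Fin (k + 1), ((-1) ^ (j : ℕ) * d (u j)) • ExteriorAlgebra.ιMulti E k fun i => u (j.succAbove i) := by
  have hc : ∀ v x, CliffordAlgebra.contractLeft (Q := (0 : QuadraticForm E M)) d
      (ExteriorAlgebra.ι E v * x) = d v • x - ExteriorAlgebra.ι E v *
        CliffordAlgebra.contractLeft (Q := (0 : QuadraticForm E M)) d x :=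
    fun v x => CliffordAlgebra.contractLeft_ι_mul (Q := (0 : QuadraticForm E M)) (d := d) v x
  induction k with
  | zero =>
    rw [ExteriorAlgebra.ιMulti_succ_apply, ExteriorAlgebra.ιMulti_zero_apply, hc]
    have h1 : CliffordAlgebra.contractLeft (Q := (0 : QuadraticForm E M)) d 1 = 0 :=
      CliffordAlgebra.contractLeft_one _ d
    refine (congrArg (fun y => _ - ExteriorAlgebra.ι E (u 0) * y) h1).trans ?_
    simp
  | succ k ih =>
    rw [ExteriorAlgebra.ιMulti_succ_apply, hc, ih, Finset.mul_sum,
      sub_eq_add_neg, ← Finset.sum_neg_distrib]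
    refine Eq.trans ?_ (Fin.sum_univ_succ _).symm
    congr 1
    · simp [Matrix.vecTail, Function.comp_def]
    · refine Finset.sum_congr rfl fun j _ => ?_
      rw [ExteriorAlgebra.ιMulti_succ_apply (v := fun i => u (j.succ.succAbove i))]
      simp [Matrix.vecTail, Function.comp_def, pow_succ]

theorem contractLeft_mem_exteriorPower {E M : Type*} [Field E] [AddCommGroup M] [Module E M]
    (d : Module.Dual E M) (k : ℕ) (x : ExteriorAlgebra E M) (hx : x ∈ ⋀[E]^k M) :
    CliffordAlgebra.contractLeft (Q := (0 : QuadraticForm E M)) d x ∈ ⋀[E]^(k - 1) M := by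
  rw [← ExteriorAlgebra.ιMulti_span_fixedDegree] at hx
  refine Submodule.span_induction (p := fun x _ => CliffordAlgebra.contractLeft
    (Q := (0 : QuadraticForm E M)) d x ∈ ⋀[E]^(k - 1) M) ?_ ?_ ?_ ?_ hx
  · rintro _ ⟨u, rfl⟩
    -- In degree 0 the truncated k - 1 is harmless, since contraction kills scalars.
    rcases k with _ | k
    · rw [ExteriorAlgebra.ιMulti_zero_apply]
      have h1 : CliffordAlgebra.contractLeft (Q := (0 : QuadraticForm E M)) d 1 = 0 :=
        CliffordAlgebra.contractLeft_one _ d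
      exact Set.mem_of_eq_of_mem h1 (Submodule.zero_mem _)
    · rw [contractLeft_ιMulti]
      exact Submodule.sum_mem _ fun j _ => Submodule.smul_mem _ _
        (ExteriorAlgebra.ιMulti_range E k ⟨_, rfl⟩)
  · rw [map_zero]
    exact Submodule.zero_mem _
  · intro x y _ _ hx hy
    rw [map_add]
    exact Submodule.add_mem _ hx hy
  · intro c x _ hx
    rw [map_smul]
    exact Submodule.smul_mem _ _ hx

variable {E₀ E W : Type*} [Field E₀] [Field E] [Algebra E₀ E] [CharZero E]
  [AddCommGroup W] [Module E W] [Module E₀ W] [IsScalarTower E₀ E W] {n : ℕ}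
  {σ : E ≃ₐ[E₀] E} {e : Module.Basis (Fin n ⊕ Fin n) E W} {a : Fin n ⊕ Fin n → E₀}
  {b : LinearMap.BilinForm E W} {ψ : W →ₗ[E₀] W →ₗ[E₀] E} {lam : E₀} {J : W →ₗ[E₀] W}

/-- The volume element `e_1 ∧ ⋯ ∧ e_n`. -/
def vol (e : Module.Basis (Fin n ⊕ Fin n) E W) : ExteriorAlgebra E (W₁ e) :=
  ExteriorAlgebra.ιMulti E n (e₁ e)

/-- The vectors `e_1, …, e_n` as a basis of `W₁`. -/
def basis₁ (e : Module.Basis (Fin n ⊕ Fin n) E W) : Module.Basis (Fin n) E (W₁ e) :=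
  Module.Basis.span (e.linearIndependent.comp Sum.inl Sum.inl_injective)

theorem basis₁_apply (i : Fin n) : basis₁ e i = e₁ e i :=
  Module.Basis.span_apply (e.linearIndependent.comp Sum.inl Sum.inl_injective) i

/-- The determinant in the basis e_1, …, e_n is a functional with value 1 on the volume element. -/
theorem vol_ne_zero : vol e ≠ 0 := by
  intro h
  have h1 := congrArg (ExteriorAlgebra.liftAlternating
    (Function.update (fun _ => 0) n (basis₁ e).det)) h
  rw [vol, ExteriorAlgebra.liftAlternating_apply_ιMulti, map_zero, Function.update_self] at h1
  have h2 : e₁ e = basis₁ e := funext fun i => (basis₁_apply i).symm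
  rw [h2, Module.Basis.det_self] at h1
  exact one_ne_zero h1

theorem ι_mul_vol (w : W₁ e) : ExteriorAlgebra.ι E w * vol e = 0 := by
  induction w using basis_induction (basis₁ e) with
  | zero => simp
  | add x y hx hy => rw [map_add, add_mul, hx, hy, add_zero]
  | smul c x hx => rw [map_smul, smul_mul_assoc, hx, smul_zero]
  | basis i =>
    have h := ExteriorAlgebra.ιMulti_succ_apply (R := E) (Fin.cons (e₁ e i) (e₁ e) : Fin (n + 1) → _)
    rw [Fin.cons_zero, show Matrix.vecTail (Fin.cons (e₁ e i) (e₁ e) : Fin (n + 1) → W₁ e) = e₁ e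
      from rfl] at h
    rw [basis₁_apply, vol, ← h]
    exact AlternatingMap.map_eq_zero_of_eq _ _ (i := 0) (j := i.succ) (by simp)
      (Fin.succ_ne_zero i).symm

theorem parity_ιMulti (k : ℕ) (u : Fin k → W₁ e) :
    parity e (ExteriorAlgebra.ιMulti E k u) = (-1 : E) ^ k • ExteriorAlgebra.ιMulti E k u := by
  induction k with
  | zero => rw [ExteriorAlgebra.ιMulti_zero_apply, parity_one, pow_zero, one_smul]
  | succ k ih => rw [ExteriorAlgebra.ιMulti_succ_apply, parity_ι_mul, ih, mul_smul_comm, pow_succ,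
      mul_neg_one, neg_smul]

/-- J maps W₁ into W₂, so J(v 0) acts by contraction alone; the remaining k-vector has the parity of
k, which selects s or t. -/
theorem IsIntertwiner.map_ιMulti_succ {s t : E} {L : ExteriorAlgebra E (W₁ e) →ₗ[E₀] _}
    (hb : IsHyperbolicBasis b e) (hL : IsIntertwiner σ b e J s t L)
    (hJ₁ : ∀ w : W₁ e, proj₁ e (J w) = 0) (k : ℕ) (v : Fin (k + 1) → W₁ e) :
    L (ExteriorAlgebra.ιMulti E (k + 1) v) = (if Even k then s else t) •
      CliffordAlgebra.contractLeft (Q := (0 : QuadraticForm E (W₁ e)))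
        (LinearMap.compl₂ b (W₁ e).subtype (J (v 0)))
        (L (ExteriorAlgebra.ιMulti E k (Matrix.vecTail v))) := by
  have hp := parity_ιMulti k (Matrix.vecTail v)
  have hp' := hL.map_parity (ExteriorAlgebra.ιMulti E k (Matrix.vecTail v))
  rw [ExteriorAlgebra.ιMulti_succ_apply, ← vectorAction_W₁ hb, hL.map_vectorAction,
    vectorAction_of_proj₁_eq_zero (hJ₁ _)]
  split_ifs with hk
  · rw [hk.neg_one_pow, one_smul] at hp
    rw [hp] at hp'
    rw [parityScale_even _ _ hp'.symm, map_smul]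
  · rw [(Nat.not_even_iff_odd.mp hk).neg_one_pow, neg_one_smul] at hp
    rw [hp, map_neg] at hp'
    rw [parityScale_odd _ _ hp'.symm, map_smul]

theorem IsIntertwiner.ιMulti_mem {s t : E} {L : ExteriorAlgebra E (W₁ e) →ₗ[E₀] _}
    (hb : IsHyperbolicBasis b e) (hL : IsIntertwiner σ b e J s t L)
    (hJ₁ : ∀ w : W₁ e, proj₁ e (J w) = 0) (h1 : L 1 ∈ ⋀[E]^n (W₁ e)) (k : ℕ) (v : Fin k → W₁ e) :
    L (ExteriorAlgebra.ιMulti E k v) ∈ ⋀[E]^(n - k) (W₁ e) := by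
  induction k with
  | zero => rwa [ExteriorAlgebra.ιMulti_zero_apply]
  | succ k ih =>
    rw [hL.map_ιMulti_succ hb hJ₁]
    exact Submodule.smul_mem _ _ (contractLeft_mem_exteriorPower _ _ _ (ih _))

/-- Let y be the image of the last k vectors of v. Then u ∧ y = 0 for degree reasons. Contracting
this relation by J(v 0) moves the contraction from y to u, where it produces the Laplace expansion
of det ψ(uᵢ, vⱼ) along the column of v 0. -/
theorem IsIntertwiner.ιMulti_mul {s t : E} {L : ExteriorAlgebra E (W₁ e) →ₗ[E₀] _}
    (hb : IsHyperbolicBasis b e) (hL : IsIntertwiner σ b e J s t L)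
    (hJ₁ : ∀ w : W₁ e, proj₁ e (J w) = 0) (hJψ : ∀ z w, b z (J w) = ψ z w)
    (γ : ℕ → E) (h1 : L 1 = γ 0 • vol e)
    (hγ : ∀ k, γ (k + 1) = (if Even k then s else -t) * γ k)
    (k : ℕ) (u v : Fin k → W₁ e) :
    ExteriorAlgebra.ιMulti E k u * L (ExteriorAlgebra.ιMulti E k v) =
      (γ k * (Matrix.of fun i j => ψ (u i) (v j)).det) • vol e := by
  induction k with
  | zero => rw [ExteriorAlgebra.ιMulti_zero_apply, ExteriorAlgebra.ιMulti_zero_apply, h1, one_mul,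
      Matrix.det_fin_zero, mul_one]
  | succ k ih =>
    rw [hL.map_ιMulti_succ hb hJ₁, mul_smul_comm]
    set d : Module.Dual E (W₁ e) := LinearMap.compl₂ b (W₁ e).subtype (J (v 0)) with hd
    set y := L (ExteriorAlgebra.ιMulti E k (Matrix.vecTail v)) with hy
    have hdu : ∀ i, d (u i) = ψ (u i) (v 0) := by
      intro i
      rw [← hJψ, form_symm hb]
      rfl
    -- By induction the last k vectors of u wedge with y to a multiple of the volume element, and
    -- one more vector annihilates it.
    have h0 : ExteriorAlgebra.ιMulti E (k + 1) u * y = 0 := by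
      rw [ExteriorAlgebra.ιMulti_succ_apply, mul_assoc, hy, ih, mul_smul_comm, ι_mul_vol, smul_zero]
    have h2 := contractLeft_mul (0 : QuadraticForm E (W₁ e)) d (ExteriorAlgebra.ιMulti E (k + 1) u) y
    have h3 := parity_ιMulti (k + 1) u
    have h4 : (0 : ExteriorAlgebra E (W₁ e)) =
        CliffordAlgebra.contractLeft (Q := (0 : QuadraticForm E (W₁ e))) d
          (ExteriorAlgebra.ιMulti E (k + 1) u) * y + parity e (ExteriorAlgebra.ιMulti E (k + 1) u) *
          CliffordAlgebra.contractLeft (Q := (0 : QuadraticForm E (W₁ e))) d y := by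
      refine Eq.trans ?_ h2
      exact (map_zero _).symm.trans (congrArg _ h0.symm)
    have h5 : CliffordAlgebra.contractLeft (Q := (0 : QuadraticForm E (W₁ e))) d
          (ExteriorAlgebra.ιMulti E (k + 1) u) * y =
        ((-1) ^ k : E) • ExteriorAlgebra.ιMulti E (k + 1) u *
          CliffordAlgebra.contractLeft (Q := (0 : QuadraticForm E (W₁ e))) d y := by
      rw [h3, pow_succ, mul_neg_one, neg_smul, neg_mul, ← sub_eq_add_neg] at h4
      exact sub_eq_zero.mp h4.symm
    have h6 : CliffordAlgebra.contractLeft (Q := (0 : QuadraticForm E (W₁ e))) d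
          (ExteriorAlgebra.ιMulti E (k + 1) u) * y =
        (γ k * (Matrix.of fun i j => ψ (u i) (v j)).det) • vol e := by
      rw [contractLeft_ιMulti, Finset.sum_mul, Matrix.det_succ_column_zero, Finset.mul_sum,
        Finset.sum_smul]
      refine Finset.sum_congr rfl fun j _ => ?_
      rw [smul_mul_assoc, hy, ih, smul_smul, hdu]
      congr 1
      simp only [Matrix.of_apply, Matrix.vecTail, Function.comp_def, Matrix.submatrix]
      ring
    have h7 : ExteriorAlgebra.ιMulti E (k + 1) u *
          CliffordAlgebra.contractLeft (Q := (0 : QuadraticForm E (W₁ e))) d y =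
        ((-1) ^ k : E) • (γ k * (Matrix.of fun i j => ψ (u i) (v j)).det) • vol e := by
      rw [← h6, h5, smul_mul_assoc, smul_smul, ← mul_pow]
      simp
    -- The sign (-1)^k from moving the contraction past u turns the factor t at odd k into the -t of
    -- the recursion.
    refine (congrArg _ h7).trans ?_
    rw [smul_smul, smul_smul, hγ]
    congr 1
    split_ifs with hk
    · rw [hk.neg_one_pow]
      ring
    · rw [(Nat.not_even_iff_odd.mp hk).neg_one_pow]
      ring

end Star

/-! ### Kernels under extension of scalars. -/

section Flat

variable {k K M N N' : Type*} [Field k] [Field K] [Algebra k K] [AddCommGroup M] [Module k M]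
  [AddCommGroup N] [Module k N] [AddCommGroup N'] [Module k N']

/-- A common kernel of finitely many linear maps is compatible with extension of scalars. -/
theorem exists_baseChange_of_forall_baseChange_eq_zero {ι : Type*} [Fintype ι] [DecidableEq ι]
    (f : ι → N →ₗ[k] N') (g : M →ₗ[k] N) (h : ∀ x, (∀ i, f i x = 0) ↔ ∃ m, g m = x)
    (x : K ⊗[k] N) (hx : ∀ i, (f i).baseChange K x = 0) : ∃ m, x = g.baseChange K m := by
  -- The hypothesis is exactness of M → N → ∏ N', which tensoring with the flat module K preserves.
  have hex : Function.Exact g (LinearMap.pi f) := by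
    intro x
    rw [Set.mem_range, ← h x]
    exact ⟨fun h i => congrFun h i, funext⟩
  have hc : ∀ x : K ⊗[k] N, TensorProduct.piRight k k K (fun _ : ι => N')
      ((LinearMap.pi f).lTensor K x) = fun i => (f i).baseChange K x := by
    intro x
    induction x using TensorProduct.induction_on with
    | zero => simp; rfl
    | tmul a y => simp
    | add x y hx hy =>
      rw [map_add, map_add, hx, hy]
      funext i
      simp
  have h0 : (LinearMap.pi f).lTensor K x = 0 := by
    refine (TensorProduct.piRight k k K (fun _ : ι => N')).injective ?_
    rw [hc, map_zero]
    exact funext hx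
  obtain ⟨m, hm⟩ := (Module.Flat.lTensor_exact K hex x).mp h0
  exact ⟨m, hm.symm⟩

theorem baseChange_injective (g : M →ₗ[k] N) (hg : Function.Injective g) :
    Function.Injective (g.baseChange K) :=
  Module.Flat.lTensor_preserves_injective_linearMap g hg

end Flat

/-! ### The conjugate-linear involution T of the Clifford algebra. -/

section Twist

variable {E₀ E W : Type*} [Field E₀] [Field E] [Algebra E₀ E] [CharZero E]
  [AddCommGroup W] [Module E W] [Module E₀ W] [IsScalarTower E₀ E W] {n : ℕ}
  {K : Type*} [Field K] [Algebra E₀ K]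
  {σ : E ≃ₐ[E₀] E} {e : Module.Basis (Fin n ⊕ Fin n) E W}
  {b : LinearMap.BilinForm E W} {ψ : W →ₗ[E₀] W →ₗ[E₀] E} {lam : E₀} {J : W →ₗ[E₀] W}

/-- `T` is the extension of `w ↦ r⁻¹ J w` to a conjugate linear automorphism of the Clifford
algebra, over a field containing a square root `r` of the multiplier of `J`. -/
structure IsTwist (σ : E ≃ₐ[E₀] E) (b : LinearMap.BilinForm E W) (J : W →ₗ[E₀] W) (r : K)
    (T : K ⊗[E₀] CliffordAlgebra (quad b) →ₐ[K] K ⊗[E₀] CliffordAlgebra (quad b)) : Prop where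
  map_scalar : ∀ c : E, T (1 ⊗ₜ algebraMap E _ c) = 1 ⊗ₜ algebraMap E _ (σ c)
  map_ι : ∀ w, T (1 ⊗ₜ CliffordAlgebra.ι (quad b) w) = r⁻¹ ⊗ₜ CliffordAlgebra.ι (quad b) (J w)

/-- With q the form `quad b`, one has r⁻² q(Jw) = r⁻² λ σ(q(w)) = σ(q(w)), so w ↦ r⁻¹Jw satisfies
the Clifford relation twisted by σ. Dividing by r is why the scalars are extended. -/
theorem exists_isTwist (hJ : IsConjSimilitude σ b lam J) (hlam : lam ≠ 0) {r : K}
    (hr : r * r = algebraMap E₀ K lam) :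
    ∃ T, IsTwist σ b J r T := by
  have hr' : r⁻¹ * r⁻¹ * algebraMap E₀ K lam = 1 := by
    have : r ≠ 0 := by
      rintro rfl
      rw [zero_mul] at hr
      exact hlam ((map_eq_zero _).mp hr.symm)
    rw [← hr]
    field_simp
  obtain ⟨F, hF1, hF2⟩ := exists_semilinear_lift (quad b)
    (((Algebra.TensorProduct.includeRight : CliffordAlgebra (quad b) →ₐ[E₀]
      K ⊗[E₀] CliffordAlgebra (quad b)) : _ →+* K ⊗[E₀] CliffordAlgebra (quad b)).comp
        ((algebraMap E (CliffordAlgebra (quad b))).comp (σ : E →+* E)))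
    (fun c x => by
      induction x using TensorProduct.induction_on with
      | zero => simp
      | tmul a y =>
        change (1 ⊗ₜ algebraMap E _ (σ c)) * _ = _ * (1 ⊗ₜ algebraMap E _ (σ c))
        rw [Algebra.TensorProduct.tmul_mul_tmul, Algebra.TensorProduct.tmul_mul_tmul, one_mul,
          mul_one, Algebra.commutes]
      | add x y hx hy => rw [mul_add, add_mul, hx, hy])
    { toFun := fun w => r⁻¹ ⊗ₜ CliffordAlgebra.ι (quad b) (J w)
      map_zero' := by simp
      map_add' := fun z w => by rw [map_add, map_add, TensorProduct.tmul_add] }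
    (fun c w => by
      change r⁻¹ ⊗ₜ CliffordAlgebra.ι (quad b) (J (c • w)) =
        (1 ⊗ₜ algebraMap E _ (σ c)) * r⁻¹ ⊗ₜ CliffordAlgebra.ι (quad b) (J w)
      rw [Algebra.TensorProduct.tmul_mul_tmul, one_mul, hJ.smul, map_smul, Algebra.smul_def])
    (fun w => by
      change r⁻¹ ⊗ₜ CliffordAlgebra.ι (quad b) (J w) * r⁻¹ ⊗ₜ CliffordAlgebra.ι (quad b) (J w) =
        1 ⊗ₜ algebraMap E _ (σ (quad b w))
      have hq : quad b (J w) = algebraMap E₀ E lam * σ (quad b w) := by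
        simp only [quad, smul_apply, LinearMap.BilinMap.toQuadraticMap_apply, hJ.form, smul_eq_mul,
          map_mul, map_inv₀, map_ofNat]
        ring
      rw [Algebra.TensorProduct.tmul_mul_tmul, CliffordAlgebra.ι_sq_scalar, hq, map_mul,
        ← Algebra.smul_def, algebraMap_smul, TensorProduct.tmul_smul, TensorProduct.smul_tmul',
        Algebra.smul_def, mul_comm, hr'])
  let Φ : CliffordAlgebra (quad b) →ₐ[E₀] K ⊗[E₀] CliffordAlgebra (quad b) :=
    { F with
      commutes' := fun c => by
        change F (algebraMap E₀ _ c) = _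
        rw [IsScalarTower.algebraMap_apply E₀ E (CliffordAlgebra (quad b)), hF1]
        change (1 : K) ⊗ₜ algebraMap E (CliffordAlgebra (quad b)) (σ (algebraMap E₀ E c)) = _
        rw [AlgEquiv.commutes, ← IsScalarTower.algebraMap_apply E₀ E (CliffordAlgebra (quad b))]
        exact (Algebra.TensorProduct.algebraMap_apply' c).symm }
  have hΦ : ∀ x, Φ x = F x := fun x => rfl
  have hcomm : ∀ (x : K) y, Commute (Algebra.ofId K (K ⊗[E₀] CliffordAlgebra (quad b)) x) (Φ y) :=
    fun x y => by
      rw [Algebra.ofId_apply]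
      exact Algebra.commute_algebraMap_left x (Φ y)
  refine ⟨Algebra.TensorProduct.lift (Algebra.ofId K _) Φ hcomm, fun c => ?_, fun w => ?_⟩
  · rw [Algebra.TensorProduct.lift_tmul, map_one, one_mul, hΦ, hF1]
    rfl
  · rw [Algebra.TensorProduct.lift_tmul, map_one, one_mul, hΦ, hF2]
    rfl

/-- The grading involution of the Clifford algebra, after extension of scalars. -/
def involuteK (K : Type*) [Field K] [Algebra E₀ K] (b : LinearMap.BilinForm E W) :
    K ⊗[E₀] CliffordAlgebra (quad b) →ₐ[K] K ⊗[E₀] CliffordAlgebra (quad b) :=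
  Algebra.TensorProduct.map (AlgHom.id K K)
    ((CliffordAlgebra.involute (Q := quad b)).restrictScalars E₀)

/-- The inclusion of the scalars in the Clifford algebra, after extension of scalars. -/
def scalarK (K : Type*) [Field K] [Algebra E₀ K] (b : LinearMap.BilinForm E W) :
    K ⊗[E₀] E →ₐ[K] K ⊗[E₀] CliffordAlgebra (quad b) :=
  Algebra.TensorProduct.map (AlgHom.id K K)
    ((Algebra.ofId E (CliffordAlgebra (quad b))).restrictScalars E₀)

theorem involuteK_tmul (a : K) (x : CliffordAlgebra (quad b)) :
    involuteK K b (a ⊗ₜ[E₀] x) = a ⊗ₜ CliffordAlgebra.involute x := rfl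

theorem scalarK_tmul (a : K) (c : E) :
    scalarK K b (a ⊗ₜ[E₀] c) = a ⊗ₜ algebraMap E (CliffordAlgebra (quad b)) c := rfl

theorem reverseK_tmul (a : K) (x : CliffordAlgebra (quad b)) :
    reverseK K b (a ⊗ₜ[E₀] x) = a ⊗ₜ CliffordAlgebra.reverse x := rfl

theorem vecIncl_tmul (a : K) (w : W) :
    vecIncl K b (a ⊗ₜ[E₀] w) = a ⊗ₜ CliffordAlgebra.ι (quad b) w := rfl

theorem reverseK_mul (x y : K ⊗[E₀] CliffordAlgebra (quad b)) :
    reverseK K b (x * y) = reverseK K b y * reverseK K b x := by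
  induction x using TensorProduct.induction_on with
  | zero => simp
  | add x z hx hz => rw [add_mul, map_add, map_add, mul_add, hx, hz]
  | tmul a x =>
    induction y using TensorProduct.induction_on with
    | zero => simp
    | add y z hy hz => rw [mul_add, map_add, map_add, add_mul, hy, hz]
    | tmul c y =>
      simp only [Algebra.TensorProduct.tmul_mul_tmul, reverseK_tmul, CliffordAlgebra.reverse.map_mul,
        mul_comm a c]

theorem reverseK_reverseK (x : K ⊗[E₀] CliffordAlgebra (quad b)) :
    reverseK K b (reverseK K b x) = x := by
  induction x using TensorProduct.induction_on with
  | zero => simp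
  | add x z hx hz => rw [map_add, map_add, hx, hz]
  | tmul a x => rw [reverseK_tmul, reverseK_tmul, CliffordAlgebra.reverse_reverse]

theorem involuteK_reverseK (x : K ⊗[E₀] CliffordAlgebra (quad b)) :
    involuteK K b (reverseK K b x) = reverseK K b (involuteK K b x) := by
  induction x using TensorProduct.induction_on with
  | zero => simp
  | add x z hx hz => simp only [map_add, hx, hz]
  | tmul a x =>
    rw [reverseK_tmul, involuteK_tmul, involuteK_tmul, reverseK_tmul,
      CliffordAlgebra.reverse_involute]

theorem involuteK_evenIncl (g : K ⊗[E₀] CliffordAlgebra.even (quad b)) :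
    involuteK K b (evenIncl K b g) = evenIncl K b g := by
  induction g using TensorProduct.induction_on with
  | zero => simp
  | add x z hx hz => simp only [map_add, hx, hz]
  | tmul a x =>
    change a ⊗ₜ CliffordAlgebra.involute (x : CliffordAlgebra (quad b)) = a ⊗ₜ (x : CliffordAlgebra (quad b))
    rw [CliffordAlgebra.involute_eq_of_mem_even x.2]

theorem reverseK_scalarK (c : K ⊗[E₀] E) : reverseK K b (scalarK K b c) = scalarK K b c := by
  induction c using TensorProduct.induction_on with
  | zero => simp
  | add x z hx hz => simp only [map_add, hx, hz]
  | tmul a x => rw [scalarK_tmul, reverseK_tmul, CliffordAlgebra.reverse.commutes]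

theorem scalarK_commute (c : K ⊗[E₀] E) (x : K ⊗[E₀] CliffordAlgebra (quad b)) :
    scalarK K b c * x = x * scalarK K b c := by
  induction c using TensorProduct.induction_on with
  | zero => simp
  | add c z hc hz => simp only [map_add, add_mul, mul_add, hc, hz]
  | tmul a c =>
    induction x using TensorProduct.induction_on with
    | zero => simp
    | add y z hy hz => simp only [add_mul, mul_add, hy, hz]
    | tmul a' y =>
      rw [scalarK_tmul, Algebra.TensorProduct.tmul_mul_tmul, Algebra.TensorProduct.tmul_mul_tmul,
        Algebra.commutes, mul_comm]

theorem scalarK_injective : Function.Injective (scalarK (E₀ := E₀) K b) := by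
  let _ : Invertible (2 : E) := invertibleOfNonzero two_ne_zero
  exact baseChange_injective (K := K)
    ((Algebra.ofId E (CliffordAlgebra (quad b))).restrictScalars E₀).toLinearMap
    (FaithfulSMul.algebraMap_injective E (CliffordAlgebra (quad b)))

/-- The Clifford relation, in terms of `ψ`. -/
theorem vecIncl_comm (hb : IsHyperbolicBasis b e) (hJψ : ∀ z w, b z (J w) = ψ z w)
    (z w : K ⊗[E₀] W) :
    vecIncl K b z * vecIncl K b (J.baseChange K w) + vecIncl K b (J.baseChange K w) *
      vecIncl K b z = scalarK K b (LinearMap.BilinMap.baseChange K ψ z w) := by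
  induction z using TensorProduct.induction_on with
  | zero => simp
  | add z z' hz hz' =>
    simp only [map_add, add_mul, mul_add, LinearMap.add_apply, ← hz, ← hz']
    abel
  | tmul a z =>
    induction w using TensorProduct.induction_on with
    | zero => simp
    | add w w' hw hw' =>
      simp only [map_add, add_mul, mul_add, ← hw, ← hw']
      abel
    | tmul a' w =>
      rw [LinearMap.baseChange_tmul, vecIncl_tmul, vecIncl_tmul,
        Algebra.TensorProduct.tmul_mul_tmul, Algebra.TensorProduct.tmul_mul_tmul, mul_comm a' a,
        ← TensorProduct.tmul_add, ι_mul_ι_add_comm (form_symm hb), hJψ, LinearMap.BilinMap.baseChange_tmul, scalarK_tmul]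

/-- Identifies the contractions by coordinate functionals with graded commutators by basis vectors.
-/
theorem IsHyperbolicBasis.form_eq_coord (hb : IsHyperbolicBasis b e) (r : Fin n ⊕ Fin n) :
    b (e r) = e.coord r.swap := by
  refine e.ext fun s => ?_
  rw [hb.form_basis, Module.Basis.coord_apply, e.repr_self, Finsupp.single_apply]
  congr 1
  rw [← Sum.swap_leftInverse.injective.eq_iff (a := r), Sum.swap_swap]
  exact propext eq_comm

/-- Nondegeneracy of b after extension of scalars: anticommutators with the basis vectors are the
coordinates, and their common kernel stays zero by flatness. The zero map from E₀ serves as the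
parametrisation of that kernel. -/
theorem eq_zero_of_vecIncl_comm (hb : IsHyperbolicBasis b e) (w : K ⊗[E₀] W)
    (hw : ∀ z, vecIncl K b z * vecIncl K b w + vecIncl K b w * vecIncl K b z = 0) : w = 0 := by
  let f : Fin n ⊕ Fin n → W →ₗ[E₀] CliffordAlgebra (quad b) := fun r =>
    (LinearMap.mulLeft E₀ (CliffordAlgebra.ι (quad b) (e r)) +
      LinearMap.mulRight E₀ (CliffordAlgebra.ι (quad b) (e r))) ∘ₗ
        (CliffordAlgebra.ι (quad b)).restrictScalars E₀
  have hf : ∀ r w, f r w = algebraMap E _ (e.repr w r.swap) := by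
    intro r w
    rw [← Module.Basis.coord_apply, ← hb.form_eq_coord, ← ι_mul_ι_add_comm (form_symm hb)]
    rfl
  obtain ⟨c, hc⟩ := exists_baseChange_of_forall_baseChange_eq_zero (K := K) f
    (0 : E₀ →ₗ[E₀] W) (fun w => by
      constructor
      · intro h
        refine ⟨0, e.repr.injective (Finsupp.ext fun r => ?_)⟩
        have h1 := h r.swap
        let _ : Invertible (2 : E) := invertibleOfNonzero two_ne_zero
        rw [hf, Sum.swap_swap, FaithfulSMul.algebraMap_eq_zero_iff] at h1
        rw [h1]
        simp
      · rintro ⟨_, rfl⟩ r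
        simp) w (fun r => by
      have h : ∀ w, (f r).baseChange K w = vecIncl K b (1 ⊗ₜ e r) * vecIncl K b w +
          vecIncl K b w * vecIncl K b (1 ⊗ₜ e r) := by
        intro w
        induction w using TensorProduct.induction_on with
        | zero => simp
        | add z w hz hw =>
          simp only [map_add, mul_add, add_mul, hz, hw]
          abel
        | tmul a w =>
          rw [LinearMap.baseChange_tmul, vecIncl_tmul, vecIncl_tmul,
            Algebra.TensorProduct.tmul_mul_tmul, Algebra.TensorProduct.tmul_mul_tmul, one_mul,
            mul_one, ← TensorProduct.tmul_add]
          rfl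
      rw [h, hw])
  rw [hc, LinearMap.baseChange_zero, LinearMap.zero_apply]

variable {r : K} {T : K ⊗[E₀] CliffordAlgebra (quad b) →ₐ[K] K ⊗[E₀] CliffordAlgebra (quad b)}

theorem IsTwist.map_vecIncl (hT : IsTwist σ b J r T) (w : K ⊗[E₀] W) :
    T (vecIncl K b w) = r⁻¹ • vecIncl K b (J.baseChange K w) := by
  induction w using TensorProduct.induction_on with
  | zero => simp
  | add x z hx hz => simp only [map_add, hx, hz, smul_add]
  | tmul a w =>
    have h : a ⊗ₜ CliffordAlgebra.ι (quad b) w = a • ((1 : K) ⊗ₜ[E₀] CliffordAlgebra.ι (quad b) w) := by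
      rw [TensorProduct.smul_tmul', smul_eq_mul, mul_one]
    rw [vecIncl_tmul, h, map_smul, hT.map_ι, LinearMap.baseChange_tmul, vecIncl_tmul,
      TensorProduct.smul_tmul', TensorProduct.smul_tmul', smul_eq_mul, smul_eq_mul, mul_comm]

theorem algHom_ext {A : Type*} [Semiring A] [Algebra K A]
    {F G : K ⊗[E₀] CliffordAlgebra (quad b) →ₐ[K] A}
    (h1 : ∀ c : E, F (1 ⊗ₜ algebraMap E _ c) = G (1 ⊗ₜ algebraMap E _ c))
    (h2 : ∀ w, F (1 ⊗ₜ CliffordAlgebra.ι (quad b) w) = G (1 ⊗ₜ CliffordAlgebra.ι (quad b) w)) :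
    F = G := by
  let i : CliffordAlgebra (quad b) →+* K ⊗[E₀] CliffordAlgebra (quad b) :=
    (Algebra.TensorProduct.includeRight :
      CliffordAlgebra (quad b) →ₐ[E₀] K ⊗[E₀] CliffordAlgebra (quad b))
  have h := ringHom_ext (F := F.toRingHom.comp i) (G := G.toRingHom.comp i) h1 h2
  refine AlgHom.ext fun x => ?_
  induction x using TensorProduct.induction_on with
  | zero => simp
  | add x z hx hz => simp only [map_add, hx, hz]
  | tmul a x =>
    have h3 : a ⊗ₜ x = a • ((1 : K) ⊗ₜ[E₀] x) := by
      rw [TensorProduct.smul_tmul', smul_eq_mul, mul_one]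
    rw [h3, map_smul, map_smul]
    exact congrArg (a • ·) (DFunLike.congr_fun h x)

/-- On vectors T² is r⁻²J² = r⁻²λ = 1, and on scalars it is σ² = 1. -/
theorem IsTwist.map_map (hT : IsTwist σ b J r T) (hJ : IsConjSimilitude σ b lam J)
    (hσ2 : ∀ c, σ (σ c) = c) (hlam : lam ≠ 0) (hr : r * r = algebraMap E₀ K lam)
    (x : K ⊗[E₀] CliffordAlgebra (quad b)) : T (T x) = x := by
  have hr0 : r ≠ 0 := by
    rintro rfl
    rw [zero_mul] at hr
    exact hlam ((map_eq_zero _).mp hr.symm)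
  have h : T.comp T = AlgHom.id K _ := by
    refine algHom_ext (fun c => ?_) fun w => ?_
    · rw [AlgHom.comp_apply, hT.map_scalar, hT.map_scalar, hσ2, AlgHom.id_apply]
    · have h : r⁻¹ ⊗ₜ CliffordAlgebra.ι (quad b) (J w) =
          r⁻¹ • ((1 : K) ⊗ₜ[E₀] CliffordAlgebra.ι (quad b) (J w)) := by
        rw [TensorProduct.smul_tmul', smul_eq_mul, mul_one]
      rw [AlgHom.comp_apply, hT.map_ι, h, map_smul, hT.map_ι, hJ.sq, ← algebraMap_smul E lam,
        map_smul, algebraMap_smul, TensorProduct.tmul_smul, TensorProduct.smul_tmul',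
        TensorProduct.smul_tmul', AlgHom.id_apply]
      congr 1
      rw [Algebra.smul_def lam, smul_eq_mul, ← hr]
      field_simp
  exact DFunLike.congr_fun h x

theorem IsTwist.map_involuteK (hT : IsTwist σ b J r T) (x : K ⊗[E₀] CliffordAlgebra (quad b)) :
    T (involuteK K b x) = involuteK K b (T x) := by
  have h : T.comp (involuteK K b) = (involuteK K b).comp T := by
    refine algHom_ext (fun c => ?_) fun w => ?_
    · simp only [AlgHom.comp_apply, hT.map_scalar, involuteK_tmul, AlgHom.commutes]
    · simp only [AlgHom.comp_apply, hT.map_ι, involuteK_tmul, CliffordAlgebra.involute_ι,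
        TensorProduct.tmul_neg, map_neg]
  exact DFunLike.congr_fun h x

theorem IsTwist.map_reverseK (hT : IsTwist σ b J r T) (x : K ⊗[E₀] CliffordAlgebra (quad b)) :
    T (reverseK K b x) = reverseK K b (T x) := by
  induction x using TensorProduct.induction_on with
  | zero => simp
  | add x z hx hz => simp only [map_add, hx, hz]
  | tmul a x =>
    have h3 : a ⊗ₜ x = a • ((1 : K) ⊗ₜ[E₀] x) := by
      rw [TensorProduct.smul_tmul', smul_eq_mul, mul_one]
    rw [h3, map_smul, map_smul, map_smul, map_smul]
    congr 1
    have hmul : ∀ x y : CliffordAlgebra (quad b),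
        (1 : K) ⊗ₜ[E₀] (x * y) = (1 ⊗ₜ x) * (1 ⊗ₜ y) := fun x y => by
      rw [Algebra.TensorProduct.tmul_mul_tmul, one_mul]
    induction x using CliffordAlgebra.induction with
    | algebraMap c =>
      rw [hT.map_scalar, reverseK_tmul, reverseK_tmul, CliffordAlgebra.reverse.commutes,
        CliffordAlgebra.reverse.commutes, hT.map_scalar]
    | ι w =>
      rw [hT.map_ι, reverseK_tmul, reverseK_tmul, CliffordAlgebra.reverse_ι,
        CliffordAlgebra.reverse_ι, hT.map_ι]
    | add x y hx hy => rw [TensorProduct.tmul_add, map_add, map_add, map_add, map_add,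
        hx (by rw [TensorProduct.smul_tmul', smul_eq_mul, mul_one]),
        hy (by rw [TensorProduct.smul_tmul', smul_eq_mul, mul_one])]
    | mul x y hx hy => rw [hmul, reverseK_mul, map_mul, map_mul, reverseK_mul,
        hx (by rw [TensorProduct.smul_tmul', smul_eq_mul, mul_one]),
        hy (by rw [TensorProduct.smul_tmul', smul_eq_mul, mul_one])]

theorem IsTwist.map_scalarK (hT : IsTwist σ b J r T) (c : K ⊗[E₀] E) :
    T (scalarK K b c) = scalarK K b (σ.toLinearMap.baseChange K c) := by
  induction c using TensorProduct.induction_on with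
  | zero => simp
  | add x z hx hz => simp only [map_add, hx, hz]
  | tmul a x =>
    have h3 : a ⊗ₜ x = a • ((1 : K) ⊗ₜ[E₀] x) := by
      rw [TensorProduct.smul_tmul', smul_eq_mul, mul_one]
    rw [h3, map_smul, map_smul, map_smul, map_smul, scalarK_tmul, hT.map_scalar,
      LinearMap.baseChange_tmul, scalarK_tmul]
    rfl

end Twist

/-! ### T fixes the preimage group up to sign, and G₁ pointwise. -/

section Sign

variable {E₀ E W : Type*} [Field E₀] [Field E] [Algebra E₀ E] [CharZero E]
  [AddCommGroup W] [Module E W] [Module E₀ W] [IsScalarTower E₀ E W] {n : ℕ}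
  {K : Type*} [Field K] [Algebra E₀ K]
  {σ : E ≃ₐ[E₀] E} {e : Module.Basis (Fin n ⊕ Fin n) E W}
  {b : LinearMap.BilinForm E W} {ψ : W →ₗ[E₀] W →ₗ[E₀] E} {lam : E₀} {J : W →ₗ[E₀] W}

/-- Left multiplication by y is injective, hence surjective in finite dimension. Applied to g g* =
1, this makes g* a two-sided inverse. -/
theorem mul_eq_one_comm_of_finite {A : Type*} [Ring A] [Algebra K A] [Module.Finite K A] {x y : A}
    (h : x * y = 1) : y * x = 1 := by
  have hinj : Function.Injective (LinearMap.mulLeft K y) := by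
    intro u v huv
    have h1 := congrArg (x * ·) huv
    simpa [← mul_assoc, h] using h1
  obtain ⟨z, hz⟩ := LinearMap.injective_iff_surjective.mp hinj 1
  rw [LinearMap.mulLeft_apply] at hz
  have : z = x := by rw [← one_mul z, ← h, mul_assoc, hz, mul_one]
  rw [← this, hz]

theorem baseChange_contractLeft (hb : IsHyperbolicBasis b e) (w : W)
    (x : K ⊗[E₀] CliffordAlgebra (quad b)) :
    ((CliffordAlgebra.contractLeft (Q := quad b) (b w)).restrictScalars E₀).baseChange K x =
      vecIncl K b (1 ⊗ₜ w) * x - involuteK K b x * vecIncl K b (1 ⊗ₜ w) := by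
  induction x using TensorProduct.induction_on with
  | zero => simp
  | add z w hz hw =>
    rw [map_add, hz, hw, map_add, mul_add, add_mul]
    abel
  | tmul a x =>
    rw [LinearMap.baseChange_tmul, vecIncl_tmul, involuteK_tmul,
      Algebra.TensorProduct.tmul_mul_tmul, Algebra.TensorProduct.tmul_mul_tmul, one_mul,
      mul_one, ← TensorProduct.tmul_sub, ι_mul_sub_involute_mul_ι (form_symm hb)]
    rfl

/-- An even element commuting with all vectors is a scalar. -/
theorem exists_scalarK_of_commute (hb : IsHyperbolicBasis b e)
    (h : K ⊗[E₀] CliffordAlgebra (quad b)) (h₀ : involuteK K b h = h)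
    (h₁ : ∀ w, vecIncl K b w * h = h * vecIncl K b w) : ∃ c, h = scalarK K b c := by
  refine exists_baseChange_of_forall_baseChange_eq_zero (K := K)
    (fun r : Fin n ⊕ Fin n =>
      (CliffordAlgebra.contractLeft (Q := quad b) (b (e r))).restrictScalars E₀)
    ((Algebra.ofId E (CliffordAlgebra (quad b))).restrictScalars E₀).toLinearMap (fun x => ?_) h
    (fun r => by rw [baseChange_contractLeft hb, h₀, h₁, sub_self])
  constructor
  · intro hx
    obtain ⟨c, hc⟩ := exists_algebraMap_of_contractLeft (quad b) e x fun r => by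
      have h2 := hx r.swap
      rw [hb.form_eq_coord, Sum.swap_swap] at h2
      exact h2
    exact ⟨c, hc.symm⟩
  · rintro ⟨c, rfl⟩ r
    exact CliffordAlgebra.contractLeft_algebraMap _ _ c

/-- The fixed points of σ on E are E₀, and by flatness those of σ on K ⊗ E are K ⊗ E₀ = K. -/
theorem exists_algebraMap_of_fixed (hfix : ∀ c, σ c = c → ∃ c₀, algebraMap E₀ E c₀ = c)
    (c : K ⊗[E₀] E) (hc : σ.toLinearMap.baseChange K c = c) :
    ∃ x, c = algebraMap K (K ⊗[E₀] E) x := by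
  obtain ⟨y, hy⟩ := exists_baseChange_of_forall_baseChange_eq_zero (K := K)
    (fun _ : Unit => σ.toLinearMap - LinearMap.id) (Algebra.linearMap E₀ E)
    (fun x => by
      constructor
      · intro h
        exact hfix x (sub_eq_zero.mp (h ()))
      · rintro ⟨c₀, rfl⟩ _
        rw [LinearMap.sub_apply]
        exact sub_eq_zero.mpr (AlgEquiv.commutes σ c₀)) c
    (fun _ => by
      rw [LinearMap.baseChange_sub, LinearMap.sub_apply, hc, LinearMap.baseChange_id,
        LinearMap.id_apply, sub_self])
  have h : ∀ y : K ⊗[E₀] E₀, ∃ x : K, y = x ⊗ₜ 1 := fun y =>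
    ⟨TensorProduct.rid E₀ K y, ((TensorProduct.rid E₀ K).symm_apply_apply y).symm.trans
      (TensorProduct.rid_symm_apply _)⟩
  obtain ⟨x, rfl⟩ := h y
  refine ⟨x, hy.trans ?_⟩
  rw [LinearMap.baseChange_tmul, Algebra.linearMap_apply, map_one]
  rfl

variable {r : K} {T : K ⊗[E₀] CliffordAlgebra (quad b) →ₐ[K] K ⊗[E₀] CliffordAlgebra (quad b)}

/-- Both G and T(G) lie over ρ, so h = G⁻¹T(G) is a scalar c. Reversal fixes scalars and agrees with
T on h, which yields both σ(c) = c and c² = 1. -/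
theorem IsTwist.eq_or_eq_neg [Module.Finite E₀ E] (hT : IsTwist σ b J r T)
    (hb : IsHyperbolicBasis b e) (hJ : IsConjSimilitude σ b lam J)
    (hJψ : ∀ z w, b z (J w) = ψ z w) (hσ2 : ∀ c, σ (σ c) = c)
    (hfix : ∀ c, σ c = c → ∃ c₀, algebraMap E₀ E c₀ = c)
    (hlam : lam ≠ 0) (hr : r * r = algebraMap E₀ K lam)
    {g : K ⊗[E₀] CliffordAlgebra.even (quad b)} (hg : g ∈ spinPreimage K b ψ) :
    T (evenIncl K b g) = evenIncl K b g ∨ T (evenIncl K b g) = -evenIncl K b g := by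
  obtain ⟨hGG, ρ, hρ, hψρ⟩ := hg
  have hα := involuteK_evenIncl (K := K) g
  set G := evenIncl K b g
  set G' := reverseK K b G with hG'
  have hr0 : r ≠ 0 := by
    rintro rfl
    rw [zero_mul] at hr
    exact hlam ((map_eq_zero _).mp hr.symm)
  have : Module.Finite E (CliffordAlgebra (quad b)) := finite_cliffordAlgebra (quad b) e
  have : Module.Finite E₀ (CliffordAlgebra (quad b)) := Module.Finite.trans E _
  have : Module.Finite E W := Module.Finite.of_basis e
  have : Module.Finite E₀ W := Module.Finite.trans E _
  have hG'G : G' * G = 1 := mul_eq_one_comm_of_finite (K := K) hGG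
  have hρ_inj : Function.Injective ρ := by
    rw [injective_iff_map_eq_zero]
    intro w hw
    have h := hρ w
    rw [hw, map_zero] at h
    have h0 : vecIncl K b w = 0 := by
      calc vecIncl K b w = G' * (G * vecIncl K b w * G') * G := by
            rw [mul_assoc G, ← mul_assoc G' G, hG'G, one_mul, mul_assoc, hG'G, mul_one]
        _ = 0 := by rw [h, mul_zero, zero_mul]
    exact eq_zero_of_vecIncl_comm hb w fun z => by rw [h0, mul_zero, zero_mul, add_zero]
  have hρ_surj : Function.Surjective ρ := LinearMap.injective_iff_surjective.mp hρ_inj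
  have hconj : ∀ x y, (G * x * G') * (G * y * G') = G * (x * y) * G' := by
    intro x y
    rw [mul_assoc, ← mul_assoc G' (G * y) G', ← mul_assoc G' G y, hG'G, one_mul]
    simp only [mul_assoc]
  -- ρ preserves the anticommutators, that is b, and it preserves ψ(z, w) = b(z, Jw). So ρJ and Jρ
  -- have the same pairing with every ρ(z), and ρ is surjective.
  have hρJ : ∀ w, ρ (J.baseChange K w) = J.baseChange K (ρ w) := by
    intro w
    refine sub_eq_zero.mp (eq_zero_of_vecIncl_comm hb _ fun z => ?_)
    obtain ⟨z, rfl⟩ := hρ_surj z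
    have h1 := vecIncl_comm (K := K) hb hJψ (ρ z) (ρ w)
    rw [hψρ, ← vecIncl_comm (K := K) hb hJψ] at h1
    have h2 : vecIncl K b (ρ z) * vecIncl K b (ρ (J.baseChange K w)) +
        vecIncl K b (ρ (J.baseChange K w)) * vecIncl K b (ρ z) =
        vecIncl K b z * vecIncl K b (J.baseChange K w) +
          vecIncl K b (J.baseChange K w) * vecIncl K b z := by
      rw [← hρ, ← hρ, hconj, hconj, ← add_mul, ← mul_add, vecIncl_comm hb hJψ, ← scalarK_commute,
        mul_assoc, hGG, mul_one]
    rw [map_sub, mul_sub, sub_mul]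
    calc _ = (vecIncl K b (ρ z) * vecIncl K b (ρ (J.baseChange K w)) +
        vecIncl K b (ρ (J.baseChange K w)) * vecIncl K b (ρ z)) -
        (vecIncl K b (ρ z) * vecIncl K b (J.baseChange K (ρ w)) +
        vecIncl K b (J.baseChange K (ρ w)) * vecIncl K b (ρ z)) := by abel
      _ = 0 := by rw [h1, h2, sub_self]
  have hJ_surj : Function.Surjective (J.baseChange K) := by
    intro w
    induction w using TensorProduct.induction_on with
    | zero => exact ⟨0, map_zero _⟩
    | add z w hz hw =>
      obtain ⟨z, rfl⟩ := hz
      obtain ⟨w, rfl⟩ := hw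
      exact ⟨z + w, map_add _ _ _⟩
    | tmul a w =>
      refine ⟨a ⊗ₜ (lam⁻¹ • J w), ?_⟩
      rw [LinearMap.baseChange_tmul, map_smul, hJ.sq, smul_smul, inv_mul_cancel₀ hlam, one_smul]
  -- Applying T to G w G' = ρ(w) replaces w by r⁻¹Jw on both sides, because ρ commutes with J; the
  -- factor r⁻¹ cancels and J is surjective.
  have hTG : ∀ w, T G * vecIncl K b w * T G' = G * vecIncl K b w * G' := by
    intro w
    obtain ⟨w, rfl⟩ := hJ_surj w
    have h1 := congrArg T (hρ w)
    rw [map_mul, map_mul, hT.map_vecIncl, hT.map_vecIncl, ← hρJ, ← hρ, mul_smul_comm,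
      smul_mul_assoc] at h1
    exact smul_right_injective _ (inv_ne_zero hr0) h1
  have hTG'G : T G' * T G = 1 := by rw [← map_mul, hG'G, map_one]
  have hTGG' : T G * T G' = 1 := by rw [← map_mul, hGG, map_one]
  have hcomm : ∀ w, vecIncl K b w * (G' * T G) = G' * T G * vecIncl K b w := by
    intro w
    calc vecIncl K b w * (G' * T G) = G' * (G * vecIncl K b w * G') * T G := by
          simp only [← mul_assoc]
          rw [hG'G, one_mul]
      _ = G' * T G * vecIncl K b w := by
          rw [← hTG]
          simp only [mul_assoc]
          rw [hTG'G, mul_one]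
  have hα' : involuteK K b (G' * T G) = G' * T G := by
    rw [map_mul, hG', involuteK_reverseK, ← hT.map_involuteK, hα]
  obtain ⟨c, hc⟩ := exists_scalarK_of_commute hb (G' * T G) hα' hcomm
  have hrev : reverseK K b (G' * T G) = T G' * G := by
    rw [reverseK_mul, hG', reverseK_reverseK, hT.map_reverseK]
  have hTh : T (G' * T G) = T G' * G := by
    rw [map_mul, hT.map_map hJ hσ2 hlam hr]
  -- K ⊗ E need not be a field, so c² = 1 alone would not give c = ±1; fixedness under σ first
  -- places c in K.
  have hfixc : σ.toLinearMap.baseChange K c = c := by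
    refine scalarK_injective (K := K) (b := b) ?_
    rw [← hT.map_scalarK, ← hc, hTh, ← hrev, hc, reverseK_scalarK]
  obtain ⟨x, rfl⟩ := exists_algebraMap_of_fixed hfix c hfixc
  rw [AlgHom.commutes] at hc
  have hTGx : T G = x • G := by
    calc T G = G * (G' * T G) := by rw [← mul_assoc, hGG, one_mul]
      _ = x • G := by rw [hc, ← Algebra.commutes, Algebra.smul_def]
  have hx : algebraMap K (K ⊗[E₀] E) (x * x) = 1 := by
    refine scalarK_injective (K := K) (b := b) ?_
    have h1 : G' * T G = T G' * G := by
      rw [← hrev, hc, ← AlgHom.commutes (scalarK (E₀ := E₀) K b), reverseK_scalarK]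
    rw [AlgHom.commutes, map_mul, ← hc, map_one]
    nth_rw 2 [h1]
    rw [mul_assoc, ← mul_assoc (T G), hTGG', one_mul, hG'G]
  have hx' : x * x = 1 := (FaithfulSMul.algebraMap_injective K (K ⊗[E₀] E)) (by rw [hx, map_one])
  rcases mul_self_eq_one_iff.mp hx' with rfl | rfl
  · exact Or.inl (by rw [hTGx, one_smul])
  · exact Or.inr (by rw [hTGx, neg_one_smul])

/-- A vector vanishes when all functionals do, so the complement is a union of non-vanishing loci of
linear polynomials. -/
theorem isClosed_zariskiTopology_ker {V U : Type*} [AddCommGroup V] [Module K V] [AddCommGroup U]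
    [Module K U] (f : V →ₗ[K] U) : @IsClosed V (zariskiTopology K V) {v | f v = 0} := by
  let _ := zariskiTopology K V
  rw [← isOpen_compl_iff]
  have h : {v | f v = 0}ᶜ = ⋃ φ : Module.Dual K U, {v | MvPolynomial.eval
      (fun d : Module.Dual K V => d v) (MvPolynomial.X (φ ∘ₗ f)) ≠ 0} := by
    ext v
    simp only [Set.mem_compl_iff, Set.mem_ofPred_eq, Set.mem_iUnion, MvPolynomial.eval_X,
      LinearMap.comp_apply]
    rw [← not_forall_not, not_iff_not]
    simp only [not_not]
    exact (Module.forall_dual_apply_eq_zero_iff K (f v)).symm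
  rw [h]
  exact isOpen_iUnion fun φ => TopologicalSpace.isOpen_generateFrom_of_mem ⟨_, rfl⟩

/-- The component of 1 is covered by the closed sets T(g) = g and T(g) = -g and meets the first at
1. If it met the second, connectedness would give a point in both, where 2g = 0, contradicting g g*
= 1. -/
theorem IsTwist.eq_of_mem_G₁ [Module.Finite E₀ E]
    {r : AlgebraicClosure E₀} {T : AlgebraicClosure E₀ ⊗[E₀] CliffordAlgebra (quad b) →ₐ[_] _}
    (hT : IsTwist σ b J r T) (hb : IsHyperbolicBasis b e) (hJ : IsConjSimilitude σ b lam J)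
    (hJψ : ∀ z w, b z (J w) = ψ z w) (hσ2 : ∀ c, σ (σ c) = c)
    (hfix : ∀ c, σ c = c → ∃ c₀, algebraMap E₀ E c₀ = c)
    (hlam : lam ≠ 0) (hr : r * r = algebraMap E₀ _ lam)
    {g : AlgebraicClosure E₀ ⊗[E₀] CliffordAlgebra.even (quad b)} (hg : g ∈ G₁ b ψ) :
    T (evenIncl _ b g) = evenIncl _ b g := by
  let V := AlgebraicClosure E₀ ⊗[E₀] CliffordAlgebra.even (quad b)
  let _ : TopologicalSpace V := zariskiTopology (AlgebraicClosure E₀) V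
  let f₁ : V →ₗ[AlgebraicClosure E₀] AlgebraicClosure E₀ ⊗[E₀] CliffordAlgebra (quad b) :=
    T.toLinearMap ∘ₗ (evenIncl _ b).toLinearMap - (evenIncl _ b).toLinearMap
  let f₂ : V →ₗ[AlgebraicClosure E₀] AlgebraicClosure E₀ ⊗[E₀] CliffordAlgebra (quad b) :=
    T.toLinearMap ∘ₗ (evenIncl _ b).toLinearMap + (evenIncl _ b).toLinearMap
  have hf₁ : ∀ g, f₁ g = T (evenIncl _ b g) - evenIncl _ b g := fun g => rfl
  have hf₂ : ∀ g, f₂ g = T (evenIncl _ b g) + evenIncl _ b g := fun g => rfl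
  let s : Set V := connectedComponentIn (spinPreimage (AlgebraicClosure E₀) b ψ) 1
  have hs : s ⊆ spinPreimage (AlgebraicClosure E₀) b ψ := connectedComponentIn_subset _ _
  have hgs : g ∈ s := hg
  have h1s : (1 : V) ∈ s := by
    -- The component would be empty if 1 were outside the preimage, but it contains g.
    refine mem_connectedComponentIn ?_
    by_contra h
    have : s = ∅ := connectedComponentIn_eq_empty h
    rw [this] at hgs
    exact hgs
  have hpre : IsPreconnected s := isPreconnected_connectedComponentIn
  have hsub : s ⊆ {g | f₁ g = 0} ∪ {g | f₂ g = 0} := by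
    intro g hg
    refine (hT.eq_or_eq_neg hb hJ hJψ hσ2 hfix hlam hr (hs hg)).imp (fun h => ?_) fun h => ?_
    · rw [Set.mem_ofPred_eq, hf₁, h, sub_self]
    · rw [Set.mem_ofPred_eq, hf₂, h, neg_add_cancel]
  by_cases hg₂ : f₂ g = 0
  · obtain ⟨x, hxs, hx₁, hx₂⟩ := isPreconnected_closed_iff.mp hpre _ _
      (isClosed_zariskiTopology_ker f₁) (isClosed_zariskiTopology_ker f₂) hsub
      ⟨1, h1s, by rw [Set.mem_ofPred_eq, hf₁, map_one, map_one, sub_self]⟩ ⟨g, hgs, hg₂⟩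
    rw [Set.mem_ofPred_eq, hf₁, sub_eq_zero] at hx₁
    rw [Set.mem_ofPred_eq, hf₂, hx₁, ← two_smul (AlgebraicClosure E₀)] at hx₂
    have h2 : (2 : AlgebraicClosure E₀) ≠ 0 := by
      have h2' : (2 : E₀) ≠ 0 := by
        intro h
        have := congrArg (algebraMap E₀ E) h
        rw [map_ofNat, map_zero] at this
        exact two_ne_zero this
      rw [← map_ofNat (algebraMap E₀ (AlgebraicClosure E₀)) 2]
      exact (map_ne_zero _).mpr h2'
    have hx0 := (smul_eq_zero.mp hx₂).resolve_left h2
    have h01 := (hs hxs).1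
    rw [hx0, zero_mul] at h01
    -- Here `h01` reads 0 = 1, so the algebra is trivial and the claim holds vacuously.
    rw [← one_mul (T _), ← one_mul (evenIncl _ b g), ← h01, zero_mul, zero_mul]
  · exact sub_eq_zero.mp ((hsub hgs).resolve_right hg₂)

end Sign

/-! ### From T-invariance of G₁ to equivariance of L on the half spin spaces. -/

section Equivariance

variable {E₀ E W : Type*} [Field E₀] [Field E] [Algebra E₀ E] [CharZero E]
  [AddCommGroup W] [Module E W] [Module E₀ W] [IsScalarTower E₀ E W] {n : ℕ}
  {K : Type*} [Field K] [Algebra E₀ K]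
  {σ : E ≃ₐ[E₀] E} {e : Module.Basis (Fin n ⊕ Fin n) E W}
  {b : LinearMap.BilinForm E W} {ψ : W →ₗ[E₀] W →ₗ[E₀] E} {lam : E₀} {J : W →ₗ[E₀] W}

theorem parity_eq_of_mem_S {x : ExteriorAlgebra E (W₁ e)} {ε : ZMod 2} (hx : x ∈ S e ε) :
    parity e x = if ε = 0 then x else -x := by
  fin_cases ε
  · exact CliffordAlgebra.involute_eq_of_mem_even hx
  · exact CliffordAlgebra.involute_eq_of_mem_odd hx

/-- The half spin spaces are the eigenspaces of the grading involution, so operators commuting with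
it restrict to them. -/
theorem mem_S_of_parity_eq {x : ExteriorAlgebra E (W₁ e)} {ε : ZMod 2}
    (hx : parity e x = if ε = 0 then x else -x) : x ∈ S e ε := by
  have htop : x ∈ S e 0 ⊔ S e 1 := by
    have h := (CliffordAlgebra.evenOdd_isCompl (Q := (0 : QuadraticForm E (W₁ e)))).sup_eq_top
    exact h ▸ Submodule.mem_top
  obtain ⟨y, hy, z, hz, rfl⟩ := Submodule.mem_sup.mp htop
  have hy' := parity_eq_of_mem_S hy
  have hz' := parity_eq_of_mem_S hz
  rw [if_pos rfl] at hy'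
  rw [if_neg one_ne_zero] at hz'
  rw [map_add, hy', hz'] at hx
  fin_cases ε
  · have h : (2 : E) • z = 0 := by
      have h1 : y + -z = y + z := hx
      rw [two_smul]
      nth_rw 1 [← add_left_cancel h1]
      exact neg_add_cancel z
    rw [(smul_eq_zero.mp h).resolve_left two_ne_zero, add_zero]
    exact hy
  · have h : (2 : E) • y = 0 := by
      have h1 : y + -z = -(y + z) := hx
      rw [neg_add] at h1
      rw [two_smul]
      nth_rw 1 [add_right_cancel h1]
      exact neg_add_cancel y
    rw [(smul_eq_zero.mp h).resolve_left two_ne_zero, zero_add]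
    exact hz

/-- The restriction of an intertwiner to a half spin space. -/
def IsIntertwiner.restrictS {s t : E} {L : ExteriorAlgebra E (W₁ e) →ₗ[E₀] _}
    (hL : IsIntertwiner σ b e J s t L) (ε : ZMod 2) : Module.End E₀ (S e ε) where
  toFun x := ⟨L x, mem_S_of_parity_eq (by
    rw [← hL.map_parity, parity_eq_of_mem_S x.2, apply_ite L, map_neg])⟩
  map_add' x y := Subtype.ext (map_add L _ _)
  map_smul' c x := Subtype.ext (map_smul L c _)

/-- The spin representation on `Res ⋀ W₁`, after extension of scalars. -/
def spinK (K : Type*) [Field K] [Algebra E₀ K] (hb : IsHyperbolicBasis b e) :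
    K ⊗[E₀] CliffordAlgebra (quad b) →ₗ[K] Module.End K (K ⊗[E₀] ExteriorAlgebra E (W₁ e)) :=
  LinearMap.liftBaseChange K
    (LinearMap.baseChangeHom E₀ K (ExteriorAlgebra E (W₁ e)) (ExteriorAlgebra E (W₁ e)) ∘ₗ
      { toFun := fun g => (spinAction hb g).restrictScalars E₀
        map_add' := fun g h => by
          ext x
          simp
        map_smul' := fun c g => by
          refine LinearMap.ext fun x => ?_
          rw [← algebraMap_smul E c g, map_smul]
          exact algebraMap_smul E c (spinAction hb g x) })

theorem spinK_tmul_tmul (hb : IsHyperbolicBasis b e) (k k' : K) (g : CliffordAlgebra (quad b))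
    (x : ExteriorAlgebra E (W₁ e)) :
    spinK (E₀ := E₀) K hb (k ⊗ₜ g) (k' ⊗ₜ x) = (k * k') ⊗ₜ spinAction hb g x := by
  rw [spinK, LinearMap.liftBaseChange_tmul, LinearMap.smul_apply]
  change k • (k' ⊗ₜ[E₀] spinAction hb g x) = _
  rw [TensorProduct.smul_tmul', smul_eq_mul]

theorem spinK_mul (hb : IsHyperbolicBasis b e) (g h : K ⊗[E₀] CliffordAlgebra (quad b))
    (x : K ⊗[E₀] ExteriorAlgebra E (W₁ e)) :
    spinK K hb (g * h) x = spinK K hb g (spinK K hb h x) := by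
  induction g using TensorProduct.induction_on with
  | zero => simp
  | add g g' hg hg' => simp only [add_mul, map_add, LinearMap.add_apply, hg, hg']
  | tmul k g =>
    induction h using TensorProduct.induction_on with
    | zero => simp
    | add h h' hh hh' => simp only [mul_add, map_add, LinearMap.add_apply, hh, hh']
    | tmul k' h =>
      induction x using TensorProduct.induction_on with
      | zero => simp
      | add x x' hx hx' => simp only [map_add, hx, hx']
      | tmul a x =>
        rw [Algebra.TensorProduct.tmul_mul_tmul, spinK_tmul_tmul, spinK_tmul_tmul, spinK_tmul_tmul,
          map_mul, Module.End.mul_apply, mul_assoc]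

/-- Lets equivariance be checked in all of ⋀W₁, where the full Clifford algebra acts. -/
theorem baseChange_subtype_actionK (hb : IsHyperbolicBasis b e) (ε : ZMod 2)
    (g : K ⊗[E₀] CliffordAlgebra.even (quad b)) (x : K ⊗[E₀] S e ε) :
    ((S e ε).subtype.restrictScalars E₀).baseChange K (actionK K hb ε g x) =
      spinK K hb (evenIncl K b g) (((S e ε).subtype.restrictScalars E₀).baseChange K x) := by
  induction g using TensorProduct.induction_on with
  | zero => simp
  | add g g' hg hg' => simp only [map_add, LinearMap.add_apply, hg, hg']
  | tmul k g =>
    induction x using TensorProduct.induction_on with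
    | zero => simp
    | add x x' hx hx' => simp only [map_add, hx, hx']
    | tmul a x =>
      have h : evenIncl K b (k ⊗ₜ[E₀] g) = k ⊗ₜ (g : CliffordAlgebra (quad b)) := rfl
      rw [h, LinearMap.baseChange_tmul, spinK_tmul_tmul, actionK, LinearMap.liftBaseChange_tmul,
        LinearMap.smul_apply]
      change ((S e ε).subtype.restrictScalars E₀).baseChange K
        (k • (a ⊗ₜ[E₀] halfSpin hb ε g x)) = _
      rw [TensorProduct.smul_tmul', smul_eq_mul, LinearMap.baseChange_tmul]
      rfl

/-- L implements T on even elements: a pair of vectors contributes st = λ⁻¹ through L and r⁻² = λ⁻¹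
through T. For a single vector the factors s, t and r⁻¹ need not match. -/
theorem IsIntertwiner.baseChange_spinK {s t : E} {L : ExteriorAlgebra E (W₁ e) →ₗ[E₀] _}
    (hL : IsIntertwiner σ b e J s t L) (hb : IsHyperbolicBasis b e)
    (hst : s * t * algebraMap E₀ E lam = 1) {r : K}
    {T : K ⊗[E₀] CliffordAlgebra (quad b) →ₐ[K] K ⊗[E₀] CliffordAlgebra (quad b)}
    (hT : IsTwist σ b J r T) (hr : r * r = algebraMap E₀ K lam)
    (g : K ⊗[E₀] CliffordAlgebra.even (quad b)) (x : K ⊗[E₀] ExteriorAlgebra E (W₁ e)) :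
    L.baseChange K (spinK K hb (evenIncl K b g) x) =
      spinK K hb (T (evenIncl K b g)) (L.baseChange K x) := by
  have hst' : s * t = algebraMap E₀ E lam⁻¹ := by
    rw [map_inv₀]
    exact eq_inv_of_mul_eq_one_left hst
  have hr' : r⁻¹ * r⁻¹ = algebraMap E₀ K lam⁻¹ := by rw [← mul_inv, hr, map_inv₀]
  have hι : ∀ v x, spinAction hb (CliffordAlgebra.ι (quad b) v) x = vectorAction b e v x :=
    fun v x => congrArg (fun f : Module.End E (ExteriorAlgebra E (W₁ e)) => f x)
      (CliffordAlgebra.lift_ι_apply _ _ v)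
  have hvv : ∀ v w y, L (vectorAction b e v (vectorAction b e w y)) =
      lam⁻¹ • vectorAction b e (J v) (vectorAction b e (J w) (L y)) := by
    intro v w y
    rw [hL.map_vectorAction, hL.map_vectorAction, parityScale_vectorAction,
      parityScale_parityScale, mul_comm t s, parityScale_self, map_smul, map_smul, hst',
      algebraMap_smul]
  have key : ∀ g ∈ CliffordAlgebra.evenOdd (quad b) 0, ∀ y : ExteriorAlgebra E (W₁ e),
      (1 : K) ⊗ₜ[E₀] L (spinAction hb g y) = spinK K hb (T (1 ⊗ₜ g)) (1 ⊗ₜ L y) := by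
    intro g hg
    induction g, hg using CliffordAlgebra.even_induction with
    | algebraMap c =>
      intro y
      rw [AlgHom.commutes, Module.algebraMap_end_apply, hL.smul, hT.map_scalar, spinK_tmul_tmul,
        AlgHom.commutes, Module.algebraMap_end_apply, mul_one]
    | add g h _ _ ihg ihh =>
      intro y
      rw [map_add, LinearMap.add_apply, map_add, TensorProduct.tmul_add, ihg, ihh,
        TensorProduct.tmul_add, map_add, map_add, LinearMap.add_apply]
    | ι_mul_ι_mul v w g _ ih =>
      intro y
      have hm : (1 : K) ⊗ₜ[E₀] (CliffordAlgebra.ι (quad b) v * CliffordAlgebra.ι (quad b) w * g) =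
          (1 ⊗ₜ CliffordAlgebra.ι (quad b) v) * (1 ⊗ₜ CliffordAlgebra.ι (quad b) w) * (1 ⊗ₜ g) := by
        simp only [Algebra.TensorProduct.tmul_mul_tmul, one_mul]
      have hx : ∀ X : K ⊗[E₀] ExteriorAlgebra E (W₁ e), spinK K hb
          (r⁻¹ ⊗ₜ CliffordAlgebra.ι (quad b) (J v) * r⁻¹ ⊗ₜ CliffordAlgebra.ι (quad b) (J w)) X =
          spinK K hb (1 ⊗ₜ (lam⁻¹ • (CliffordAlgebra.ι (quad b) (J v) *
            CliffordAlgebra.ι (quad b) (J w)))) X := by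
        intro X
        rw [Algebra.TensorProduct.tmul_mul_tmul, hr', TensorProduct.tmul_smul,
          TensorProduct.smul_tmul', Algebra.algebraMap_eq_smul_one]
      rw [hm, map_mul T, map_mul T, hT.map_ι, hT.map_ι, spinK_mul, ← ih, hx, spinK_tmul_tmul,
        map_mul (spinAction hb), map_mul (spinAction hb), Module.End.mul_apply,
        Module.End.mul_apply, hι, hι, hvv, mul_one, ← algebraMap_smul E lam⁻¹,
        ← algebraMap_smul E lam⁻¹, map_smul, LinearMap.smul_apply, map_mul, Module.End.mul_apply,
        hι, hι]
  induction g using TensorProduct.induction_on with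
  | zero => simp
  | add g g' hg hg' => simp only [map_add, LinearMap.add_apply, hg, hg']
  | tmul k g =>
    induction x using TensorProduct.induction_on with
    | zero => simp
    | add x x' hx hx' => simp only [map_add, hx, hx']
    | tmul a x =>
      have h : evenIncl K b (k ⊗ₜ[E₀] g) = k • ((1 : K) ⊗ₜ[E₀] (g : CliffordAlgebra (quad b))) := by
        rw [TensorProduct.smul_tmul', smul_eq_mul, mul_one]
        rfl
      have h' : ∀ y : ExteriorAlgebra E (W₁ e), a ⊗ₜ[E₀] y = a • ((1 : K) ⊗ₜ[E₀] y) := fun y => by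
        rw [TensorProduct.smul_tmul', smul_eq_mul, mul_one]
      rw [h, h']
      simp only [map_smul, LinearMap.smul_apply]
      rw [spinK_tmul_tmul, LinearMap.baseChange_tmul, LinearMap.baseChange_tmul, mul_one,
        key _ g.2]

/-- Combines L g = T(g) L with T(g) = g on G₁. Rational points follow from points over the algebraic
closure by faithful flatness. -/
theorem IsIntertwiner.isEquivariant [Module.Finite E₀ E] {s t : E}
    {L : ExteriorAlgebra E (W₁ e) →ₗ[E₀] _}
    (hL : IsIntertwiner σ b e J s t L) (hb : IsHyperbolicBasis b e)
    (hst : s * t * algebraMap E₀ E lam = 1) (hJ : IsConjSimilitude σ b lam J)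
    (hJψ : ∀ z w, b z (J w) = ψ z w) (hσ2 : ∀ c, σ (σ c) = c)
    (hfix : ∀ c, σ c = c → ∃ c₀, algebraMap E₀ E c₀ = c) (hlam : lam ≠ 0) (ε : ZMod 2) :
    IsEquivariant hb ψ ε (hL.restrictS ε) := by
  obtain ⟨r, hr⟩ := IsAlgClosed.exists_eq_mul_self
    (algebraMap E₀ (AlgebraicClosure E₀) lam)
  obtain ⟨T, hT⟩ := exists_isTwist hJ hlam hr.symm
  have hres : ∀ x : AlgebraicClosure E₀ ⊗[E₀] S e ε,
      ((S e ε).subtype.restrictScalars E₀).baseChange _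
        ((hL.restrictS ε).baseChange (AlgebraicClosure E₀) x) =
      L.baseChange _ (((S e ε).subtype.restrictScalars E₀).baseChange _ x) := by
    intro x
    induction x using TensorProduct.induction_on with
    | zero => simp
    | add x y hx hy => simp only [map_add, hx, hy]
    | tmul a x => rfl
  have h1 : ∀ g ∈ G₁ b ψ, ∀ x : AlgebraicClosure E₀ ⊗[E₀] S e ε,
      (hL.restrictS ε).baseChange (AlgebraicClosure E₀) (actionK (AlgebraicClosure E₀) hb ε g x) =
      actionK (AlgebraicClosure E₀) hb ε g
        ((hL.restrictS ε).baseChange (AlgebraicClosure E₀) x) := by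
    intro g hg x
    refine baseChange_injective (K := AlgebraicClosure E₀) ((S e ε).subtype.restrictScalars E₀)
      Subtype.val_injective ?_
    rw [hres, baseChange_subtype_actionK, baseChange_subtype_actionK, hres,
      hL.baseChange_spinK hb hst hT hr.symm,
      hT.eq_of_mem_G₁ hb hJ hJψ hσ2 hfix hlam hr.symm hg]
  refine ⟨h1, fun g hg x => ?_⟩
  have h2 := h1 _ hg (1 ⊗ₜ x)
  have hact : ∀ y : S e ε, actionK (AlgebraicClosure E₀) hb ε (1 ⊗ₜ[E₀] g) (1 ⊗ₜ[E₀] y) =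
      1 ⊗ₜ halfSpin hb ε g y := by
    intro y
    rw [actionK, LinearMap.liftBaseChange_tmul, one_smul]
    rfl
  rw [hact, LinearMap.baseChange_tmul, LinearMap.baseChange_tmul, hact] at h2
  have hinj : Function.Injective fun y : S e ε => (1 : AlgebraicClosure E₀) ⊗ₜ[E₀] y :=
    Module.FaithfullyFlat.tensorProduct_mk_injective (A := E₀) (B := AlgebraicClosure E₀) (S e ε)
  exact hinj h2

end Equivariance

/-! ### Quadratic extensions, the choice of coefficients, and the computation of the squares. -/

section Main

variable {E₀ E W : Type*} [Field E₀] [Field E] [Algebra E₀ E] [CharZero E]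
  [AddCommGroup W] [Module E W] [Module E₀ W] [IsScalarTower E₀ E W] {n m : ℕ}
  {σ : E ≃ₐ[E₀] E} {e : Module.Basis (Fin n ⊕ Fin n) E W} {a : Fin n ⊕ Fin n → E₀}
  {b : LinearMap.BilinForm E W} {ψ : W →ₗ[E₀] W →ₗ[E₀] E} {lam : E₀}

/-- There are at most two automorphisms over E₀, while 1, σ, σ² would be distinct if σ² ≠ 1. -/
theorem conj_conj_of_finrank_eq_two (h : Module.finrank E₀ E = 2) (σ : E ≃ₐ[E₀] E) (c : E) :
    σ (σ c) = c := by
  have : Module.Finite E₀ E := Module.finite_of_finrank_eq_succ h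
  have hcard : Nat.card (E ≃ₐ[E₀] E) ≤ 2 := by
    rw [Nat.card_eq_fintype_card, ← h]
    exact AlgEquiv.card_le
  have hσ : σ ^ 2 = 1 := by
    by_contra hne
    have hinj : Function.Injective (![1, σ, σ ^ 2] : Fin 3 → (E ≃ₐ[E₀] E)) := by
      have h1 : σ ≠ 1 := by
        rintro rfl
        exact hne (one_pow 2)
      have h2 : σ ^ 2 ≠ σ := by
        intro h
        rw [pow_two] at h
        exact h1 (mul_eq_left.mp h)
      intro i j hij
      fin_cases i <;> fin_cases j <;> simp_all [eq_comm]
    have h3 := Nat.card_le_card_of_injective _ hinj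
    rw [Nat.card_eq_fintype_card (α := Fin 3), Fintype.card_fin] at h3
    omega
  exact DFunLike.congr_fun hσ c

/-- The degree is prime, so the fixed field of σ is E₀ or E, and σ ≠ 1 excludes E. -/
theorem exists_algebraMap_of_fixed_of_finrank_eq_two (h : Module.finrank E₀ E = 2)
    (hσ : σ ≠ AlgEquiv.refl) (c : E) (hc : σ c = c) : ∃ c₀, algebraMap E₀ E c₀ = c := by
  have := IntermediateField.isSimpleOrder_of_finrank_prime E₀ E (h ▸ Nat.prime_two)
  rcases eq_bot_or_eq_top (IntermediateField.fixedField (Subgroup.zpowers σ)) with hF | hF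
  · have hmem : c ∈ IntermediateField.fixedField (Subgroup.zpowers σ) := by
      rw [IntermediateField.mem_fixedField_iff]
      intro f hf
      have hle : Subgroup.zpowers σ ≤ MulAction.stabilizer (E ≃ₐ[E₀] E) c := by
        rw [Subgroup.zpowers_le]
        exact hc
      exact hle hf
    rw [hF] at hmem
    exact IntermediateField.mem_bot.mp hmem
  · refine absurd (AlgEquiv.ext fun x => ?_) hσ
    have hmem : x ∈ IntermediateField.fixedField (Subgroup.zpowers σ) := hF ▸ trivial
    exact (IntermediateField.mem_fixedField_iff _ _).mp hmem σ (Subgroup.mem_zpowers σ)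

theorem proj₁_conjMap (w : W₁ e) : proj₁ e (conjMap σ e a (w : W)) = 0 := by
  induction w using basis_induction (basis₁ e) with
  | zero => simp
  | add x y hx hy => rw [Submodule.coe_add, map_add, map_add, hx, hy, add_zero]
  | smul c x hx => rw [Submodule.coe_smul, conjMap_smul, map_smul, hx, smul_zero]
  | basis i =>
    rw [basis₁_apply]
    change proj₁ e (conjMap σ e a (e (Sum.inl i))) = 0
    rw [conjMap_basis, ← algebraMap_smul E, map_smul, Sum.swap_inl,
      show proj₁ e (e (Sum.inr i)) = 0 from Subtype.ext (proj₁_inr i), smul_zero]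

theorem conjMap_mem_W₁ (w : W) (hw : proj₁ e w = 0) : conjMap σ e a w ∈ W₁ e := by
  -- Writing elements of W₂ as w - proj₁ w removes the side condition, so that induction on the
  -- basis of W applies.
  have h : ∀ w : W, conjMap σ e a (w - proj₁ e w) ∈ W₁ e := by
    intro w
    induction w using basis_induction e with
    | zero => simp
    | add x y hx hy =>
      have h1 : x + y - ((proj₁ e (x + y) : W₁ e) : W) = (x - proj₁ e x) + (y - proj₁ e y) := by
        rw [map_add, Submodule.coe_add]
        abel
      rw [h1, map_add]
      exact Submodule.add_mem _ hx hy
    | smul c x hx =>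
      rw [map_smul, Submodule.coe_smul, ← smul_sub, conjMap_smul]
      exact Submodule.smul_mem _ _ hx
    | basis r =>
      rcases r with i | i
      · rw [proj₁_inl, sub_self, map_zero]
        exact Submodule.zero_mem _
      · rw [proj₁_inr, sub_zero, conjMap_basis, ← algebraMap_smul E]
        exact Submodule.smul_mem _ _ (e₁ e i).2
  simpa [hw] using h w

/-- The factor `(-1)^d lam^{-d}`, `d = ⌊(k - m) / 2⌋`. -/
def starCoeff (lam : E₀) (m k : ℕ) : E₀ :=
  (-1) ^ (((k : ℤ) - m) / 2) * lam ^ (-(((k : ℤ) - m) / 2))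

theorem starCoeff_succ_of_even (lam : E₀) {m k : ℕ} (h : Even ((k : ℤ) - m)) :
    starCoeff lam m (k + 1) = starCoeff lam m k := by
  obtain ⟨d, hd⟩ := h
  have h1 : ((k + 1 : ℕ) : ℤ) - m = 1 + 2 * d := by push_cast; linarith
  have h2 : (k : ℤ) - m = 2 * d := by linarith
  have h3 : (1 + 2 * d) / 2 = d := by omega
  have h4 : 2 * d / 2 = d := by omega
  rw [starCoeff, starCoeff, h1, h2, h3, h4]

theorem starCoeff_succ_of_odd (hlam : lam ≠ 0) {m k : ℕ} (h : Odd ((k : ℤ) - m)) :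
    starCoeff lam m (k + 1) = -lam⁻¹ * starCoeff lam m k := by
  obtain ⟨d, hd⟩ := h
  have h1 : ((k + 1 : ℕ) : ℤ) - m = 2 * d + 2 := by push_cast; linarith
  have h3 : (2 * d + 2) / 2 = d + 1 := by omega
  have h4 : (2 * d + 1) / 2 = d := by omega
  rw [starCoeff, starCoeff, h1, hd, h3, h4, neg_add, zpow_add₀ (by simp), zpow_add₀ hlam]
  simp only [zpow_one, zpow_neg]
  ring

/-- The product of the factors in degrees `0` and `n = 2 m`. -/
theorem starCoeff_zero_mul (hlam : lam ≠ 0) (m : ℕ) :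
    starCoeff lam m 0 * starCoeff lam m (2 * m) = if Even m then 1 else -lam := by
  have h : starCoeff lam m 0 * starCoeff lam m (2 * m) =
      (-1) ^ ((((0 : ℕ) : ℤ) - m) / 2 + (((2 * m : ℕ) : ℤ) - m) / 2) *
        lam ^ (-((((0 : ℕ) : ℤ) - m) / 2 + (((2 * m : ℕ) : ℤ) - m) / 2)) := by
    rw [starCoeff, starCoeff, neg_add, zpow_add₀ (by simp), zpow_add₀ hlam]
    ring
  rw [h]
  split_ifs with hm
  · obtain ⟨d, rfl⟩ := hm
    -- The exponent is ⌊-m/2⌋ + ⌊m/2⌋ with division rounding down: 0 for even m, -1 for odd m.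
    rw [show (((0 : ℕ) : ℤ) - (d + d : ℕ)) / 2 + (((2 * (d + d) : ℕ) : ℤ) - (d + d : ℕ)) / 2 = 0 by
      push_cast; omega]
    simp
  · obtain ⟨d, rfl⟩ := Nat.not_even_iff_odd.mp hm
    rw [show (((0 : ℕ) : ℤ) - (2 * d + 1 : ℕ)) / 2 +
      (((2 * (2 * d + 1) : ℕ) : ℤ) - (2 * d + 1 : ℕ)) / 2 = -1 by push_cast; omega]
    simp

/-- The scalars by which the rescaled star operator intertwines the action of vectors. -/
def starScale (lam : E₀) (m : ℕ) : E₀ × E₀ := if Even m then (1, lam⁻¹) else (-lam⁻¹, -1)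

theorem starScale_mul (hlam : lam ≠ 0) (m : ℕ) :
    (starScale lam m).1 * (starScale lam m).2 * lam = 1 := by
  unfold starScale
  split_ifs <;> simp [hlam]

/-- The floor increases exactly when k - m is odd, so the step factor is 1 or -λ⁻¹ according to
parity. Reading it as s for even k and -t for odd k is what dictates `starScale`. -/
theorem starCoeff_succ (hlam : lam ≠ 0) (m k : ℕ) :
    starCoeff lam m (k + 1) =
      (if Even k then (starScale lam m).1 else -(starScale lam m).2) * starCoeff lam m k := by
  have hpar : Even ((k : ℤ) - m) ↔ (Even k ↔ Even m) := by
    rw [Int.even_sub, Int.even_coe_nat, Int.even_coe_nat]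
  by_cases h : Even ((k : ℤ) - m)
  · rw [starCoeff_succ_of_even lam h]
    rw [hpar] at h
    by_cases hk : Even k
    · simp [starScale, hk, h.mp hk]
    · have hm : ¬Even m := fun hm => hk (h.mpr hm)
      simp [starScale, hk, hm]
  · rw [starCoeff_succ_of_odd hlam (Int.not_even_iff_odd.mp h)]
    rw [hpar] at h
    by_cases hk : Even k
    · have hm : ¬Even m := fun hm => h ⟨fun _ => hm, fun _ => hk⟩
      simp [starScale, hk, hm]
    · have hm : Even m := by
        by_contra hm
        exact h ⟨fun h' => absurd h' hk, fun h' => absurd h' hm⟩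
      simp [starScale, hk, hm]

/-- The rescaled star operator on `⋀ W₁`. -/
theorem exists_rescaledStar (hn : n = 2 * m) (hσ2 : ∀ c, σ (σ c) = c) (hψ : IsHermitianForm σ ψ)
    (he : IsGoodBasis b ψ e a lam) (hlam : lam ≠ 0) :
    ∃ L, IsIntertwiner σ b e (conjMap σ e a) (algebraMap E₀ E (starScale lam m).1)
      (algebraMap E₀ E (starScale lam m).2) L ∧
      (∀ k (v : Fin k → W₁ e), L (ExteriorAlgebra.ιMulti E k v) ∈ ⋀[E]^(n - k) (W₁ e)) ∧
      (∀ k (u v : Fin k → W₁ e),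
        ExteriorAlgebra.ιMulti E k u * L (ExteriorAlgebra.ιMulti E k v) =
          (algebraMap E₀ E (starCoeff lam m k) * (Matrix.of fun i j => ψ (u i) (v j)).det) •
            vol e) ∧
      L (L 1) = algebraMap E₀ E ((if Even m then 1 else -lam) * discr a) •
        (1 : ExteriorAlgebra E (W₁ e)) := by
  have hb := he.hyperbolic
  have hJ := isConjSimilitude_conjMap hσ2 hψ he
  have hst : algebraMap E₀ E (starScale lam m).1 * algebraMap E₀ E (starScale lam m).2 *
      algebraMap E₀ E lam = 1 := by
    rw [← map_mul, ← map_mul, starScale_mul hlam, map_one]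
  -- Evenness of n enters here: the image of 1 must be even for L to preserve the half spin spaces.
  have hpar : parity e (vol e) = vol e := by
    rw [vol, parity_ιMulti, (hn ▸ even_two_mul m : Even n).neg_one_pow, one_smul]
  obtain ⟨L, hL, hL1⟩ := exists_isIntertwiner hb hJ conjMap_mem_W₁ hst
    (algebraMap E₀ E (starCoeff lam m 0) • vol e) (by rw [map_smul, hpar])
    (fun w => by rw [map_smul, vectorAction_W₁ hb, ι_mul_vol, smul_zero])
  have hmem : ∀ k (v : Fin k → W₁ e),
      L (ExteriorAlgebra.ιMulti E k v) ∈ ⋀[E]^(n - k) (W₁ e) :=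
    hL.ιMulti_mem hb proj₁_conjMap (hL1 ▸ Submodule.smul_mem _ _
      (ExteriorAlgebra.ιMulti_range E n ⟨_, rfl⟩))
  have hmul := hL.ιMulti_mul hb proj₁_conjMap (form_conjMap hψ he)
    (fun k => algebraMap E₀ E (starCoeff lam m k)) hL1
    (fun k => by
      rw [starCoeff_succ hlam, map_mul]
      split_ifs <;> simp)
  refine ⟨L, hL, hmem, hmul, ?_⟩
  -- L(vol) has degree 0, so it is a scalar c. Pairing vol with itself gives c as the degree n
  -- coefficient times det ψ|W₁ = D, and L(L 1) then carries the product of the coefficients in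
  -- degrees 0 and n.
  have h1 := hmem n (e₁ e)
  rw [Nat.sub_self] at h1
  obtain ⟨c, hc⟩ := Submodule.mem_one.mp (by simpa using h1)
  have h2 := hmul n (e₁ e) (e₁ e)
  have hdet : (Matrix.of fun i j => ψ ((e₁ e i : W₁ e) : W) (e₁ e j : W₁ e)).det =
      algebraMap E₀ E (discr a) := by
    have h3 : (Matrix.of fun i j => ψ ((e₁ e i : W₁ e) : W) (e₁ e j : W₁ e)) =
        Matrix.diagonal fun i => algebraMap E₀ E (a (Sum.inl i)) := by
      ext i j
      rw [Matrix.of_apply, Matrix.diagonal_apply]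
      refine (he.diagonal (Sum.inl i) (Sum.inl j)).trans ?_
      simp only [Sum.inl.injEq]
    rw [h3, Matrix.det_diagonal, discr, map_prod]
  rw [hdet, ← hc] at h2
  have h3 : c • vol e = (algebraMap E₀ E (starCoeff lam m n) * algebraMap E₀ E (discr a)) • vol e := by
    rw [← h2, Algebra.smul_def]
    exact Algebra.commutes c (vol e)
  have h4 := smul_left_injective E (vol_ne_zero (e := e)) h3
  rw [hL1, hL.smul, AlgEquiv.commutes, vol, ← hc, h4,
    Algebra.algebraMap_eq_smul_one (A := ExteriorAlgebra E (W₁ e)), smul_smul,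
    ← map_mul, ← map_mul, ← mul_assoc, ← starCoeff_zero_mul hlam, ← hn]

theorem exists_operators (hE : IsImaginaryQuadratic E₀ E) (hσ : σ ≠ AlgEquiv.refl)
    (hn : n = 2 * m) (hψ : IsHermitianForm σ ψ) (he : IsGoodBasis b ψ e a lam) (hlam : lam ≠ 0)
    (ε : ZMod 2) :
    ∃ L : Module.End E₀ (S e ε), IsConjLinear σ e ε L ∧ IsEquivariant he.hyperbolic ψ ε L ∧
      IsRescaledStar ψ e lam m ε L ∧
      ∀ x, L (L x) = algebraMap E₀ E ((-1) ^ m * discr a *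
        if ε = 0 then (if Even m then 1 else lam) else (if Even m then lam else 1)) • x := by
  have : Module.Finite E₀ E := Module.finite_of_finrank_eq_succ hE.1
  have hσ2 := conj_conj_of_finrank_eq_two hE.1 σ
  have hfix := exists_algebraMap_of_fixed_of_finrank_eq_two hE.1 hσ
  have hJ := isConjSimilitude_conjMap hσ2 hψ he
  obtain ⟨L, hL, hmem, hmul, hsq⟩ := exists_rescaledStar hn hσ2 hψ he hlam
  have hst := starScale_mul hlam m
  refine ⟨hL.restrictS ε, fun c x => Subtype.ext (hL.smul c x),
    hL.isEquivariant he.hyperbolic (by rw [← map_mul, ← map_mul, hst, map_one]) hJ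
      (form_conjMap hψ he) hσ2 hfix hlam ε,
    fun k v hv => ⟨hmem k v, fun u => hmul k u v⟩, fun x => Subtype.ext ?_⟩
  refine (hL.sq he.hyperbolic hJ hσ2 hst hsq x).trans ?_
  have hx := parity_eq_of_mem_S x.2
  rw [Submodule.coe_smul]
  -- The even part has q = D for even m and q = -λD for odd m. The odd part has λs²q, with s = 1 for
  -- even m and s = -λ⁻¹ for odd m, giving λD and -D.
  by_cases hε : ε = 0
  · rw [if_pos hε] at hx
    rw [parityScale_even _ _ hx, if_pos hε]
    congr 2
    by_cases hm : Even m
    · simp [hm, hm.neg_one_pow]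
    · simp [hm, (Nat.not_even_iff_odd.mp hm).neg_one_pow, mul_comm]
  · rw [if_neg hε] at hx
    rw [parityScale_odd _ _ hx, if_neg hε, ← map_mul]
    congr 2
    by_cases hm : Even m
    · simp [starScale, hm, hm.neg_one_pow, mul_comm]
    · simp only [starScale, hm, (Nat.not_even_iff_odd.mp hm).neg_one_pow, if_false]
      field_simp

/-- A vanishing a_r would put e_r in the radical of ψ. An index i is required, since for n = 0
nothing constrains λ. -/
theorem IsGoodBasis.lam_ne_zero (hψ : IsHermitianForm σ ψ) (he : IsGoodBasis b ψ e a lam)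
    (i : Fin n) : lam ≠ 0 := by
  have ha : ∀ r, a r ≠ 0 := by
    intro r h
    refine e.ne_zero r (hψ.nondegenerate _ fun w => ?_)
    induction w using basis_induction e with
    | zero => simp
    | add x y hx hy => rw [map_add, hx, hy, add_zero]
    | smul c x hx => rw [hψ.smul_right, hx, mul_zero]
    | basis s => rw [he.diagonal, h, map_zero, ite_self]
  rw [← he.mul_eq i]
  exact mul_ne_zero (ha _) (ha _)

/-- For n = m = 0 the exponent d is 0 in degree 0, and in positive degree the determinant vanishes
because W₁ = 0; so λ plays no role. -/
theorem IsRescaledStar.congr_of_n_eq_zero {ε : ZMod 2} {L : Module.End E₀ (S e ε)} {lam' : E₀}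
    (hn : n = 0) (hL : IsRescaledStar ψ e lam 0 ε L) : IsRescaledStar ψ e lam' 0 ε L := by
  subst hn
  intro k v hv
  refine ⟨(hL k v hv).1, fun u => ((hL k v hv).2 u).trans ?_⟩
  rcases k with _ | k
  · simp
  · have hu : ∀ j, ψ (u 0) (v j) = 0 := by
      intro j
      have h0 : ((u 0 : W₁ e) : W) = 0 :=
        e.repr.injective (Finsupp.ext fun r => r.elim Fin.elim0 Fin.elim0)
      rw [h0, map_zero, LinearMap.zero_apply]
    rw [Matrix.det_eq_zero_of_row_eq_zero 0 (fun j => hu j), mul_zero, mul_zero]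

/-- With W₁ = 0 the contraction condition is vacuous, so every element is a scalar, hence even. -/
theorem eq_zero_of_n_eq_zero (hn : n = 0) (x : S e 1) : x = 0 := by
  have hx := parity_eq_of_mem_S x.2
  rw [if_neg one_ne_zero] at hx
  have hx' : parity e (x : ExteriorAlgebra E (W₁ e)) = x := by
    obtain ⟨c, hc⟩ := exists_algebraMap_of_contractLeft_exterior (basis₁ e)
      (x : ExteriorAlgebra E (W₁ e)) fun i => (Fin.cast hn i).elim0
    rw [hc, Algebra.algebraMap_eq_smul_one, map_smul, parity_one]
  have h2 : (2 : E) • (x : ExteriorAlgebra E (W₁ e)) = 0 := by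
    rw [two_smul]
    nth_rw 1 [← hx', hx]
    exact neg_add_cancel _
  exact Subtype.ext ((smul_eq_zero.mp h2).resolve_left two_ne_zero)

end Main

end HalfSpin

end

theorem theorem3 {E₀ E W : Type*} [Field E₀] [Field E] [Algebra E₀ E] [CharZero E]
    (hE₀ : HalfSpin.IsBaseField E₀) (hE : HalfSpin.IsImaginaryQuadratic E₀ E)
    (σ : E ≃ₐ[E₀] E) (hσ : σ ≠ AlgEquiv.refl)
    [AddCommGroup W] [Module E W] [Module E₀ W] [IsScalarTower E₀ E W]
    (m n : ℕ) (hn : n = 2 * m)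
    (b : LinearMap.BilinForm E W) (ψ : W →ₗ[E₀] W →ₗ[E₀] E)
    (hψ : HalfSpin.IsHermitianForm σ ψ)
    (e : Module.Basis (Fin n ⊕ Fin n) E W) (a : Fin n ⊕ Fin n → E₀) (lam : E₀)
    (he : HalfSpin.IsGoodBasis b ψ e a lam) :
    (∃ L : Module.End E₀ (HalfSpin.S e 0),
      HalfSpin.IsConjLinear σ e 0 L ∧
      HalfSpin.IsEquivariant he.hyperbolic ψ 0 L ∧
      HalfSpin.IsRescaledStar ψ e lam m 0 L ∧
      (Even m → ∀ x, L (L x) =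
        algebraMap E₀ E ((-1) ^ m * HalfSpin.discr a) • x) ∧
      (Odd m → ∀ x, L (L x) =
        algebraMap E₀ E ((-1) ^ m * HalfSpin.discr a * lam) • x)) ∧
    (∃ L : Module.End E₀ (HalfSpin.S e 1),
      HalfSpin.IsConjLinear σ e 1 L ∧
      HalfSpin.IsEquivariant he.hyperbolic ψ 1 L ∧
      HalfSpin.IsRescaledStar ψ e lam m 1 L ∧
      (Even m → ∀ x, L (L x) =
        algebraMap E₀ E ((-1) ^ m * HalfSpin.discr a * lam) • x) ∧
      (Odd m → ∀ x, L (L x) =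
        algebraMap E₀ E ((-1) ^ m * HalfSpin.discr a) • x)) := by
  -- For n = 0 the scalar λ may be zero, so the construction is run with λ = 1; the conclusions do
  -- not see the change, S⁻ being zero.
  rcases Nat.eq_zero_or_pos n with h0 | hpos
  · obtain rfl : m = 0 := by omega
    have he' : HalfSpin.IsGoodBasis b ψ e a 1 :=
      ⟨he.hyperbolic, he.diagonal, fun i => (Fin.cast h0 i).elim0⟩
    obtain ⟨L, hL₁, hL₂, hL₃, hL₄⟩ :=
      HalfSpin.exists_operators hE hσ hn hψ he' one_ne_zero 0
    obtain ⟨L', hL'₁, hL'₂, hL'₃, hL'₄⟩ :=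
      HalfSpin.exists_operators hE hσ hn hψ he' one_ne_zero 1
    refine ⟨⟨L, hL₁, hL₂, hL₃.congr_of_n_eq_zero h0, fun hm x => ?_, fun hm => ?_⟩,
      ⟨L', hL'₁, hL'₂, hL'₃.congr_of_n_eq_zero h0, fun hm x => ?_, fun hm => ?_⟩⟩
    · simpa using hL₄ x
    · simp at hm
    · rw [HalfSpin.eq_zero_of_n_eq_zero h0 x, map_zero, map_zero, smul_zero]
    · simp at hm
  · have hlam := he.lam_ne_zero hψ ⟨0, hpos⟩
    obtain ⟨L, hL₁, hL₂, hL₃, hL₄⟩ := HalfSpin.exists_operators hE hσ hn hψ he hlam 0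
    obtain ⟨L', hL'₁, hL'₂, hL'₃, hL'₄⟩ := HalfSpin.exists_operators hE hσ hn hψ he hlam 1
    refine ⟨⟨L, hL₁, hL₂, hL₃, fun hm x => ?_, fun hm x => ?_⟩,
      ⟨L', hL'₁, hL'₂, hL'₃, fun hm x => ?_, fun hm x => ?_⟩⟩
    · simpa [hm] using hL₄ x
    · simpa [Nat.not_even_iff_odd.mpr hm] using hL₄ x
    · simpa [hm] using hL'₄ x
    · simpa [Nat.not_even_iff_odd.mpr hm] using hL'₄ x
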